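/- Superrings are supercommutative $\mathbb Z/2$-graded rings in which odd elements have square zero (automatic if $2$ is invertible). Let $S$ be a superscheme and let $X$ be a superscheme over $S$ with an action $\sigma:\mathbb A^{0|1}_S\times_S X\to X$ over $S$ of the odd additive group $\mathbb A^{0|1}_S$. Such an action is the identity on underlying spaces; let $v:\mathcal O_X\to\mathcal O_X$ be the corresponding homological vector field (an odd derivation with $v^2=0$), determined by $\sigma^*(s)=s+\varepsilon\, v(s)$, where $\varepsilon$ is the odd coordinate on $\mathbb A^{0|1}$. Then the following conditions are equivalent: (2) locally on $X$ there exist $n\ge 0$ and homogeneous functions $a_1,\dots,a_n$, $b_1,\dots,b_n$, with $a_i$ and $b_i$ of opposite parity for each $i$, such that $\sum_{i=1}^n a_i v(b_i)=1$; (3) locally on $X$ there exists an odd function $\theta$ such that $v(\theta)$ is invertible; (4) locally on $X$ there exists an odd function $\theta$ such that $v(\theta)=1$; (5) the subsheaves $\ker(v:\mathcal O_X\to\mathcal O_X)$ and $\operatorname{im}(v:\mathcal O_X\to\mathcal O_X)$ of $\mathcal O_X$ are equal. If $X$ is separated over $S$ (the diagonal $X\to X\times_S X$ is a closed embedding), they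 are also equivalent to (1) the action is free, i.e. the morphism $\mathbb A^{0|1}_S\times_S X\to X\times_S X$, $(g,x)\mapsto (gx,x)$, is a closed embedding. Without assuming that $X$ is separated over $S$, conditions (2)-(5) are equivalent to (1') the morphism $\mathbb A^{0|1}_S\times_S X\to X\times_S X$, $(g,x)\mapsto (gx,x)$, is a locally closed embedding. -/

import Mathlib

open CategoryTheory TopologicalSpace Opposite

universe u

/-! ## Supercommutative rings -/

section Superrings

variable {A B : Type u} [Ring A] [Ring B]

/-- A `ℤ/2`-graded ring `A = A₀ ⊕ A₁` is supercommutative if `a b = (-1)^{|a| |b|} b a` for homogeneous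
`a, b`, and odd elements have square zero (the latter follows from the former if `2` is invertible). -/
structure IsSupercommutative (𝒜 : ZMod 2 → AddSubgroup A) : Prop where
  comm : ∀ {i j : ZMod 2} {a b : A}, a ∈ 𝒜 i → b ∈ 𝒜 j → a * b = (-1) ^ (i.val * j.val) * (b * a)
  odd_mul_self : ∀ {a : A}, a ∈ 𝒜 1 → a * a = 0

namespace SuperRing

open GradedRing

variable (𝒜 : ZMod 2 → AddSubgroup A) [GradedRing 𝒜]
variable (ℬ : ZMod 2 → AddSubgroup B) [GradedRing ℬ]

lemma zero_or_one (i : ZMod 2) : i = 0 ∨ i = 1 := by revert i; decide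

lemma proj_zero_add_proj_one (a : A) : proj 𝒜 0 a + proj 𝒜 1 a = a := by
  classical
  have h := DirectSum.sum_support_decompose 𝒜 a
  rw [Finset.sum_subset (Finset.subset_univ _) (fun i _ hi => by simpa using hi),
    show (Finset.univ : Finset (ZMod 2)) = {0, 1} from rfl, Finset.sum_pair (by decide)] at h
  simpa [proj_apply] using h

lemma proj_same {i : ZMod 2} {a : A} (h : a ∈ 𝒜 i) : proj 𝒜 i a = a := by
  rw [proj_apply, DirectSum.decompose_of_mem_same 𝒜 h]

lemma proj_ne {i j : ZMod 2} {a : A} (h : a ∈ 𝒜 i) (hij : i ≠ j) : proj 𝒜 j a = 0 := by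
  rw [proj_apply, DirectSum.decompose_of_mem_ne 𝒜 h hij]

lemma proj_mem (i : ZMod 2) (a : A) : proj 𝒜 i a ∈ 𝒜 i := by
  rw [proj_apply]; exact SetLike.coe_mem _

/-- The parity involution `a₀ + a₁ ↦ a₀ - a₁`. -/
def parityInvol : A →+ A := proj 𝒜 0 - proj 𝒜 1

lemma parityInvol_even {a : A} (h : a ∈ 𝒜 0) : parityInvol 𝒜 a = a := by
  simp [parityInvol, proj_same 𝒜 h, proj_ne 𝒜 h (show (0 : ZMod 2) ≠ 1 by decide)]

lemma parityInvol_odd {a : A} (h : a ∈ 𝒜 1) : parityInvol 𝒜 a = -a := by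
  simp [parityInvol, proj_same 𝒜 h, proj_ne 𝒜 h (show (1 : ZMod 2) ≠ 0 by decide)]

lemma parityInvol_mem {i : ZMod 2} {a : A} (h : a ∈ 𝒜 i) : parityInvol 𝒜 a ∈ 𝒜 i := by
  obtain rfl | rfl : i = 0 ∨ i = 1 := zero_or_one i
  · rwa [parityInvol_even 𝒜 h]
  · rw [parityInvol_odd 𝒜 h]; exact neg_mem h

lemma parityInvol_one : parityInvol 𝒜 1 = 1 :=
  parityInvol_even 𝒜 SetLike.GradedOne.one_mem

lemma parityInvol_mul (a b : A) :
    parityInvol 𝒜 (a * b) = parityInvol 𝒜 a * parityInvol 𝒜 b := by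
  rw [← proj_zero_add_proj_one 𝒜 a, ← proj_zero_add_proj_one 𝒜 b]
  have h0 := proj_mem 𝒜 0 a
  have h1 := proj_mem 𝒜 1 a
  have k0 := proj_mem 𝒜 0 b
  have k1 := proj_mem 𝒜 1 b
  generalize proj 𝒜 0 a = a₀ at *
  generalize proj 𝒜 1 a = a₁ at *
  generalize proj 𝒜 0 b = b₀ at *
  generalize proj 𝒜 1 b = b₁ at *
  have m00 : a₀ * b₀ ∈ 𝒜 0 := SetLike.GradedMul.mul_mem h0 k0
  have m01 : a₀ * b₁ ∈ 𝒜 1 := by simpa using SetLike.GradedMul.mul_mem h0 k1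
  have m10 : a₁ * b₀ ∈ 𝒜 1 := by simpa using SetLike.GradedMul.mul_mem h1 k0
  have m11 : a₁ * b₁ ∈ 𝒜 0 := by
    simpa [show (1 : ZMod 2) + 1 = 0 by decide] using SetLike.GradedMul.mul_mem h1 k1
  simp only [mul_add, add_mul, map_add, parityInvol_even 𝒜 h0, parityInvol_even 𝒜 k0,
    parityInvol_odd 𝒜 h1, parityInvol_odd 𝒜 k1, parityInvol_even 𝒜 m00, parityInvol_odd 𝒜 m01,
    parityInvol_odd 𝒜 m10, parityInvol_even 𝒜 m11]
  noncomm_ring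

variable {𝒜 ℬ} in
lemma map_parityInvol (φ : A →+* B) (h : ∀ i, ∀ a ∈ 𝒜 i, φ a ∈ ℬ i) (a : A) :
    φ (parityInvol 𝒜 a) = parityInvol ℬ (φ a) := by
  rw [← proj_zero_add_proj_one 𝒜 a]
  simp only [map_add, parityInvol_even 𝒜 (proj_mem 𝒜 0 a), parityInvol_odd 𝒜 (proj_mem 𝒜 1 a),
    parityInvol_even ℬ (h _ _ (proj_mem 𝒜 0 a)), parityInvol_odd ℬ (h _ _ (proj_mem 𝒜 1 a)),
    map_neg]

end SuperRing

/-- The commutative ring of even elements of a supercommutative ring. -/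
def evenSubring (𝒜 : ZMod 2 → AddSubgroup A) [GradedRing 𝒜] : Subring A where
  carrier := 𝒜 0
  mul_mem' h k := by simpa using SetLike.GradedMul.mul_mem h k
  one_mem' := SetLike.GradedOne.one_mem
  add_mem' := add_mem
  zero_mem' := zero_mem _
  neg_mem' := neg_mem

/-- Even elements commute with everything. -/
lemma IsSupercommutative.even_comm {𝒜 : ZMod 2 → AddSubgroup A} [GradedRing 𝒜]
    (h : IsSupercommutative 𝒜) {a : A} (ha : a ∈ 𝒜 0) (b : A) : a * b = b * a := by
  rw [← SuperRing.proj_zero_add_proj_one 𝒜 b, mul_add, add_mul,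
    h.comm ha (SuperRing.proj_mem 𝒜 0 b), h.comm ha (SuperRing.proj_mem 𝒜 1 b)]
  simp

/-- The even subring is commutative. -/
abbrev IsSupercommutative.commRing {𝒜 : ZMod 2 → AddSubgroup A} [GradedRing 𝒜]
    (h : IsSupercommutative 𝒜) : CommRing (evenSubring 𝒜) :=
  { (inferInstance : Ring (evenSubring 𝒜)) with
    mul_comm := fun a b => Subtype.ext (h.even_comm a.2 b.1) }

/-- The superring `A[ε]` with `ε` odd: elements are `a + ε b`, with `a, b ∈ A`, where `ε² = 0` and
`a ε = ε ā` for `ā` the parity involution. -/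
@[ext] structure OddExt (𝒜 : ZMod 2 → AddSubgroup A) where
  /-- the coefficient `a` of `1` in `a + ε b` -/
  re : A
  /-- the coefficient `b` of `ε` in `a + ε b` -/
  eps : A

namespace OddExt

open GradedRing SuperRing

variable (𝒜 : ZMod 2 → AddSubgroup A)

instance : Zero (OddExt 𝒜) := ⟨⟨0, 0⟩⟩
instance : One (OddExt 𝒜) := ⟨⟨1, 0⟩⟩
instance : Add (OddExt 𝒜) := ⟨fun x y => ⟨x.re + y.re, x.eps + y.eps⟩⟩
instance : Neg (OddExt 𝒜) := ⟨fun x => ⟨-x.re, -x.eps⟩⟩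
instance [GradedRing 𝒜] : Mul (OddExt 𝒜) :=
  ⟨fun x y => ⟨x.re * y.re, x.eps * y.re + parityInvol 𝒜 x.re * y.eps⟩⟩

@[simp] lemma re_zero : (0 : OddExt 𝒜).re = 0 := rfl
@[simp] lemma eps_zero : (0 : OddExt 𝒜).eps = 0 := rfl
@[simp] lemma re_one : (1 : OddExt 𝒜).re = 1 := rfl
@[simp] lemma eps_one : (1 : OddExt 𝒜).eps = 0 := rfl
variable {𝒜}
@[simp] lemma re_add (x y : OddExt 𝒜) : (x + y).re = x.re + y.re := rfl
@[simp] lemma eps_add (x y : OddExt 𝒜) : (x + y).eps = x.eps + y.eps := rfl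
@[simp] lemma re_neg (x : OddExt 𝒜) : (-x).re = -x.re := rfl
@[simp] lemma eps_neg (x : OddExt 𝒜) : (-x).eps = -x.eps := rfl
@[simp] lemma re_mul [GradedRing 𝒜] (x y : OddExt 𝒜) : (x * y).re = x.re * y.re := rfl
@[simp] lemma eps_mul [GradedRing 𝒜] (x y : OddExt 𝒜) :
    (x * y).eps = x.eps * y.re + parityInvol 𝒜 x.re * y.eps := rfl

instance [GradedRing 𝒜] : Ring (OddExt 𝒜) :=
  Ring.ofMinimalAxioms
    (fun x y z => by ext <;> simp [add_assoc])
    (fun x => by ext <;> simp)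
    (fun x => by ext <;> simp)
    (fun x y z => by ext <;> simp [mul_assoc, add_mul, mul_add, parityInvol_mul, add_assoc])
    (fun x => by ext <;> simp [parityInvol_one])
    (fun x => by ext <;> simp)
    (fun x y z => by
      ext
      · simp [mul_add]
      · simp only [eps_mul, eps_add, re_add, mul_add]; abel)
    (fun x y z => by
      ext
      · simp [add_mul]
      · simp only [eps_mul, eps_add, re_add, add_mul, map_add]; abel)

variable [GradedRing 𝒜]

variable (𝒜) in
/-- The grading of `A[ε]`, for which `ε` is odd: `a + ε b` has parity `i` iff `a` has parity `i` and
`b` has parity `i + 1`. -/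
def parity (i : ZMod 2) : AddSubgroup (OddExt 𝒜) where
  carrier := {x | x.re ∈ 𝒜 i ∧ x.eps ∈ 𝒜 (i + 1)}
  add_mem' h k := ⟨add_mem h.1 k.1, add_mem h.2 k.2⟩
  zero_mem' := ⟨zero_mem _, zero_mem _⟩
  neg_mem' h := ⟨neg_mem h.1, neg_mem h.2⟩

lemma mem_parity {i : ZMod 2} {x : OddExt 𝒜} :
    x ∈ parity 𝒜 i ↔ x.re ∈ 𝒜 i ∧ x.eps ∈ 𝒜 (i + 1) := Iff.rfl

variable (𝒜) in
/-- The homogeneous component of an element of `A[ε]`. -/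
def component (i : ZMod 2) : OddExt 𝒜 →+ parity 𝒜 i where
  toFun x := ⟨⟨proj 𝒜 i x.re, proj 𝒜 (i + 1) x.eps⟩, proj_mem _ _ _, proj_mem _ _ _⟩
  map_zero' := by ext <;> simp
  map_add' x y := by ext <;> simp

instance instGradedRing : GradedRing (parity 𝒜) where
  one_mem := ⟨SetLike.GradedOne.one_mem, zero_mem _⟩
  mul_mem i j x y hx hy := by
    refine ⟨SetLike.GradedMul.mul_mem hx.1 hy.1, add_mem ?_ ?_⟩
    · have := SetLike.GradedMul.mul_mem hx.2 hy.1
      rwa [add_right_comm] at this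
    · have := SetLike.GradedMul.mul_mem (parityInvol_mem 𝒜 hx.1) hy.2
      rwa [← add_assoc] at this
  toDecomposition := DirectSum.Decomposition.ofAddHom (ℳ := parity 𝒜)
    ((DirectSum.of (fun i => parity 𝒜 i) 0).comp (component 𝒜 0) +
      (DirectSum.of (fun i => parity 𝒜 i) 1).comp (component 𝒜 1))
    (by
      ext x
      · simpa [component] using proj_zero_add_proj_one 𝒜 x.re
      · have := proj_zero_add_proj_one 𝒜 x.eps
        rw [add_comm] at this
        simpa [component, show (1 : ZMod 2) + 1 = 0 by decide] using this)
    (by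
      ext i x : 2
      have h10 : (1 : ZMod 2) + 1 = 0 := by decide
      have hx1 := x.2.1
      have hx2 := x.2.2
      obtain rfl | rfl := zero_or_one i
      · have e0 : component 𝒜 0 x = x := by
          ext <;> simp only [component, AddMonoidHom.coe_mk, ZeroHom.coe_mk]
          exacts [proj_same 𝒜 hx1, proj_same 𝒜 hx2]
        have e1 : component 𝒜 1 x = 0 := by
          ext <;> simp only [component, AddMonoidHom.coe_mk, ZeroHom.coe_mk]
          exacts [proj_ne 𝒜 hx1 (by decide), proj_ne 𝒜 hx2 (by decide)]
        simp [e0, e1]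
      · have e0 : component 𝒜 0 x = 0 := by
          ext <;> simp only [component, AddMonoidHom.coe_mk, ZeroHom.coe_mk]
          exacts [proj_ne 𝒜 hx1 (by decide), proj_ne 𝒜 hx2 (by decide)]
        have e1 : component 𝒜 1 x = x := by
          ext <;> simp only [component, AddMonoidHom.coe_mk, ZeroHom.coe_mk]
          exacts [proj_same 𝒜 hx1, proj_same 𝒜 hx2]
        simp [e0, e1])

lemma isSupercommutative (h : IsSupercommutative 𝒜) : IsSupercommutative (parity 𝒜) where
  comm {i j x y} hx hy := by
    obtain ⟨hx1, hx2⟩ := hx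
    obtain ⟨hy1, hy2⟩ := hy
    have e1 := h.comm hx1 hy1
    have e2 := h.comm hx2 hy1
    have e3 := h.comm hx1 hy2
    have v1 : (1 : ZMod 2).val = 1 := rfl
    have v2 : (1 + 1 : ZMod 2).val = 0 := rfl
    obtain rfl | rfl := zero_or_one i
    all_goals
      obtain rfl | rfl := zero_or_one j
      all_goals
        simp only [v1, v2, zero_add, ZMod.val_zero, mul_zero, pow_zero, one_mul, mul_one,
          pow_one, neg_mul] at e1 e2 e3 ⊢
        ext
        · simp [e1]
        · first
          | simp [parityInvol_even 𝒜 hx1, parityInvol_even 𝒜 hy1, e2, e3, add_comm]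
          | simp [parityInvol_even 𝒜 hx1, parityInvol_odd 𝒜 hy1, e2, e3, add_comm]
          | simp [parityInvol_odd 𝒜 hx1, parityInvol_even 𝒜 hy1, e2, e3, add_comm]
          | simp [parityInvol_odd 𝒜 hx1, parityInvol_odd 𝒜 hy1, e2, e3]
  odd_mul_self {x} hx := by
    obtain ⟨hx1, hx2⟩ := hx
    have e := h.comm hx2 hx1
    have v1 : (1 : ZMod 2).val = 1 := rfl
    have v2 : (1 + 1 : ZMod 2).val = 0 := rfl
    rw [v1, v2] at e
    ext
    · simp [h.odd_mul_self hx1]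
    · simp at e
      simp [parityInvol_odd 𝒜 hx1, e]

variable {ℬ : ZMod 2 → AddSubgroup B} [GradedRing ℬ]

/-- The homomorphism `A[ε] → B[ε]` induced by an even homomorphism `A → B`. -/
def map (φ : A →+* B) (h : ∀ i, ∀ a ∈ 𝒜 i, φ a ∈ ℬ i) : OddExt 𝒜 →+* OddExt ℬ where
  toFun x := ⟨φ x.re, φ x.eps⟩
  map_one' := by ext <;> simp
  map_zero' := by ext <;> simp
  map_add' x y := by ext <;> simp
  map_mul' x y := by ext <;> simp [map_parityInvol φ h]

variable (𝒜) in
/-- The inclusion `A → A[ε]`. -/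
def incl : A →+* OddExt 𝒜 where
  toFun a := ⟨a, 0⟩
  map_one' := rfl
  map_zero' := rfl
  map_add' x y := by ext <;> simp
  map_mul' x y := by ext <;> simp

variable (𝒜) in
/-- The homomorphism `A[ε] → A`, `ε ↦ 0`. -/
def evalZero : OddExt 𝒜 →+* A where
  toFun x := x.re
  map_one' := rfl
  map_zero' := rfl
  map_add' _ _ := rfl
  map_mul' _ _ := rfl

variable (𝒜) in
/-- The homomorphism `A[ε] → A[ε₁][ε₂]`, `ε ↦ ε₁ + ε₂`. -/
def coadd : OddExt 𝒜 →+* OddExt (parity 𝒜) where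
  toFun x := ⟨⟨x.re, x.eps⟩, ⟨x.eps, 0⟩⟩
  map_one' := by ext <;> simp
  map_zero' := by ext <;> simp
  map_add' x y := by ext <;> simp
  map_mul' x y := by
    have key : ∀ z : OddExt 𝒜, parityInvol (parity 𝒜) z =
        ⟨parityInvol 𝒜 z.re, -parityInvol 𝒜 z.eps⟩ := by
      intro z
      obtain ⟨a, b⟩ := z
      have hd : (⟨a, b⟩ : OddExt 𝒜) =
          ⟨proj 𝒜 0 a, proj 𝒜 1 b⟩ + ⟨proj 𝒜 1 a, proj 𝒜 0 b⟩ := by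
        ext
        · exact (proj_zero_add_proj_one 𝒜 a).symm
        · simpa [add_comm] using (proj_zero_add_proj_one 𝒜 b).symm
      have h0 : (⟨proj 𝒜 0 a, proj 𝒜 1 b⟩ : OddExt 𝒜) ∈ parity 𝒜 0 :=
        ⟨proj_mem _ _ _, proj_mem _ _ _⟩
      have h1 : (⟨proj 𝒜 1 a, proj 𝒜 0 b⟩ : OddExt 𝒜) ∈ parity 𝒜 1 :=
        ⟨proj_mem _ _ _, proj_mem _ _ _⟩
      conv_lhs => rw [hd, map_add, parityInvol_even _ h0, parityInvol_odd _ h1]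
      ext <;> simp [parityInvol, sub_eq_add_neg]
    ext <;> simp [key]

lemma isUnit_iff {x : OddExt 𝒜} : IsUnit x ↔ IsUnit x.re := by
  refine ⟨fun h => h.map (evalZero 𝒜), fun h => ?_⟩
  obtain ⟨u, hu⟩ := h
  have e1 : (incl 𝒜 u) * ⟨1, parityInvol 𝒜 (↑u⁻¹ : A) * x.eps⟩ = x := by
    ext
    · simp [incl, hu]
    · simp [incl, ← mul_assoc, ← parityInvol_mul, parityInvol_one]
  rw [← e1]
  refine ((Units.isUnit u).map (incl 𝒜)).mul ?_
  generalize parityInvol 𝒜 (↑u⁻¹ : A) * x.eps = c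
  exact ⟨⟨⟨1, c⟩, ⟨1, -c⟩, by ext <;> simp [parityInvol_one], by ext <;> simp [parityInvol_one]⟩, rfl⟩

lemma pow_succ_eq (h : IsSupercommutative 𝒜) {r : OddExt 𝒜} (hr : r.re ∈ 𝒜 0) (n : ℕ) :
    r ^ (n + 1) = ⟨r.re ^ (n + 1), (n + 1 : ℕ) * r.eps * r.re ^ n⟩ := by
  induction n with
  | zero => ext <;> simp
  | succ n ih =>
    rw [pow_succ', ih]
    ext
    · simp [pow_succ']
    · simp only [eps_mul, parityInvol_even _ hr]
      rw [h.even_comm hr, mul_assoc _ (r.re ^ n), ← pow_succ]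
      push_cast
      noncomm_ring

lemma pow_mem_even {a : A} (ha : a ∈ 𝒜 0) (n : ℕ) : a ^ n ∈ 𝒜 0 := by
  simpa using SetLike.pow_mem_graded n ha

/-- If `φ : A → B` is the localization at the even part of the even element `s` of `A[ε]`, then
`A[ε] → B[ε]` is the localization at `s`. -/
lemma isLocalization (hA : IsSupercommutative 𝒜) (hB : IsSupercommutative ℬ) (φ : A →+* B)
    (hφ : ∀ i, ∀ a ∈ 𝒜 i, φ a ∈ ℬ i) (s : OddExt 𝒜) (hs : s.re ∈ 𝒜 0) (h1 : IsUnit (φ s.re))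
    (h2 : ∀ t : B, ∃ (n : ℕ) (a : A), φ s.re ^ n * t = φ a)
    (h3 : ∀ a : A, φ a = 0 → ∃ n : ℕ, s.re ^ n * a = 0) :
    IsUnit (map φ hφ s) ∧
    (∀ t : OddExt ℬ, ∃ (n : ℕ) (a : OddExt 𝒜), map φ hφ s ^ n * t = map φ hφ a) ∧
    (∀ a : OddExt 𝒜, map φ hφ a = 0 → ∃ n : ℕ, s ^ n * a = 0) := by
  have hs' : (map φ hφ s).re ∈ ℬ 0 := hφ 0 _ hs
  refine ⟨isUnit_iff.mpr h1, fun t => ?_, fun a ha => ?_⟩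
  · obtain ⟨n, c, hc⟩ := h2 t.re
    obtain ⟨m, d, hd⟩ := h2 t.eps
    refine ⟨n + m + 1, ⟨s.re ^ (m + 1) * c,
      (n + m + 1 : ℕ) * s.eps * (s.re ^ m * c) + s.re ^ (n + 1) * d⟩, ?_⟩
    rw [pow_succ_eq hB hs']
    refine OddExt.ext ?_ ?_
    · change φ s.re ^ (n + m + 1) * t.re = φ (s.re ^ (m + 1) * c)
      rw [map_mul, map_pow, ← hc, ← mul_assoc, ← pow_add]
      congr 2
      omega
    · rw [eps_mul, parityInvol_even _ (pow_mem_even hs' _)]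
      change (n + m + 1 : ℕ) * φ s.eps * φ s.re ^ (n + m) * t.re + φ s.re ^ (n + m + 1) * t.eps =
        φ ((n + m + 1 : ℕ) * s.eps * (s.re ^ m * c) + s.re ^ (n + 1) * d)
      simp only [map_add, map_mul, map_pow, map_natCast, ← hc, ← hd]
      rw [← mul_assoc _ _ t.re, ← pow_add, add_comm m n, ← mul_assoc _ _ t.eps,
        ← pow_add, show n + 1 + m = n + m + 1 by omega, mul_assoc _ _ t.re]
  · obtain ⟨n, hn⟩ := h3 a.re (congrArg OddExt.re ha)
    obtain ⟨m, hm⟩ := h3 a.eps (congrArg OddExt.eps ha)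
    refine ⟨n + m + 1, ?_⟩
    have hn' : s.re ^ (n + m) * a.re = 0 := by
      rw [add_comm n m, pow_add, mul_assoc, hn, mul_zero]
    rw [pow_succ_eq hA hs]
    refine OddExt.ext ?_ ?_
    · change s.re ^ (n + m + 1) * a.re = 0
      rw [pow_succ', mul_assoc, hn', mul_zero]
    · rw [eps_mul, parityInvol_even _ (pow_mem_even hs _), mul_assoc _ _ a.re]
      rw [hn', mul_zero, zero_add, show n + m + 1 = n + 1 + m by omega, pow_add, mul_assoc, hm,
        mul_zero, eps_zero]

end OddExt

end Superrings

/-! ## Superschemes -/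

/-- A superringed space: a topological space with a sheaf of supercommutative rings. -/
structure SuperRingedSpace extends AlgebraicGeometry.SheafedSpace.{u + 1, u, u} RingCat.{u} where
  /-- the subgroup of sections of a given parity -/
  parity (U : Opens carrier) : ZMod 2 → AddSubgroup (presheaf.obj (op U))
  [graded (U : Opens carrier) : GradedRing (parity U)]
  supercomm (U : Opens carrier) : IsSupercommutative (parity U)
  map_mem {U V : Opens carrier} (i : U ⟶ V) (p : ZMod 2) (s : presheaf.obj (op V)) :
    s ∈ parity V p → presheaf.map i.op s ∈ parity U p

attribute [instance] SuperRingedSpace.graded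

namespace SuperRingedSpace

variable (X : SuperRingedSpace.{u})

instance (U : Opens X.carrier) : CommRing (evenSubring (X.parity U)) := (X.supercomm U).commRing

variable {X} in
/-- `V` is the open `D(s)` of points of `U` at which the section `s` over `U` is invertible. -/
def IsBasicOpen {U : Opens X.carrier} (s : X.presheaf.obj (op U)) (V : Opens X.carrier) : Prop :=
  ∀ x, x ∈ V ↔ ∃ hx : x ∈ U, IsUnit (X.presheaf.germ U x hx s)

/-- The open `U` is affine, i.e. `(U, O_X|_U)` is the spectrum of the superring `A = O_X(U)`: sending a
point `x` to the prime ideal `{s ∈ A₀ | s is not invertible at x}` is a homeomorphism `U ≃ Spec A₀`, and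
for each `s ∈ A₀` the restriction `A → O_X(D(s))` is the localization `A → A[s⁻¹]` (spelled out in the
three parts of the second field). -/
structure IsAffineOpen (U : Opens X.carrier) : Prop where
  exists_homeomorph : ∃ h : U ≃ₜ PrimeSpectrum (evenSubring (X.parity U)),
    ∀ (x : U) (s : evenSubring (X.parity U)),
      s ∈ (h x).asIdeal ↔ ¬ IsUnit (X.presheaf.germ U x.1 x.2 s.1)
  isLocalization : ∀ s ∈ X.parity U 0, ∀ (V : Opens X.carrier) (i : V ⟶ U), IsBasicOpen s V →
    IsUnit (X.presheaf.map i.op s) ∧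
    (∀ t : X.presheaf.obj (op V), ∃ (n : ℕ) (a : X.presheaf.obj (op U)),
      X.presheaf.map i.op s ^ n * t = X.presheaf.map i.op a) ∧
    (∀ a : X.presheaf.obj (op U), X.presheaf.map i.op a = 0 → ∃ n : ℕ, s ^ n * a = 0)

/-- The restriction maps of `O_X[ε]`. -/
def oddLineMap {U V : Opens X.carrier} (i : U ⟶ V) :
    OddExt (X.parity V) →+* OddExt (X.parity U) :=
  OddExt.map (X.presheaf.map i.op).hom (X.map_mem i)

/-- The presheaf `O_X[ε]`. -/
def oddLinePresheaf : TopCat.Presheaf RingCat.{u} X.carrier where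
  obj U := RingCat.of (OddExt (X.parity U.unop))
  map i := RingCat.ofHom (X.oddLineMap i.unop)
  map_id U := by
    ext x
    · exact ConcreteCategory.congr_hom (X.presheaf.map_id U) x.re
    · exact ConcreteCategory.congr_hom (X.presheaf.map_id U) x.eps
  map_comp i j := by
    ext x
    · exact ConcreteCategory.congr_hom (X.presheaf.map_comp i j) x.re
    · exact ConcreteCategory.congr_hom (X.presheaf.map_comp i j) x.eps

lemma oddLinePresheaf_isSheaf : X.oddLinePresheaf.IsSheaf := by
  rw [TopCat.Presheaf.isSheaf_iff_isSheafUniqueGluing]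
  intro ι U sf hsf
  have H := X.IsSheaf
  rw [TopCat.Presheaf.isSheaf_iff_isSheafUniqueGluing] at H
  obtain ⟨a, ha, ha'⟩ := H U (fun i => (sf i).re) (fun i j => congrArg OddExt.re (hsf i j))
  obtain ⟨b, hb, hb'⟩ := H U (fun i => (sf i).eps) (fun i j => congrArg OddExt.eps (hsf i j))
  refine ⟨⟨a, b⟩, fun i => OddExt.ext (ha i) (hb i), fun c hc => OddExt.ext ?_ ?_⟩
  · exact ha' _ fun i => congrArg OddExt.re (hc i)
  · exact hb' _ fun i => congrArg OddExt.eps (hc i)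

/-- The superringed space `𝔸^{0|1} × X = (|X|, O_X[ε])`. -/
def oddLine : SuperRingedSpace.{u} where
  carrier := X.carrier
  presheaf := X.oddLinePresheaf
  IsSheaf := X.oddLinePresheaf_isSheaf
  parity U := OddExt.parity (X.parity U)
  graded _ := OddExt.instGradedRing
  supercomm U := OddExt.isSupercommutative (X.supercomm U)
  map_mem i p _ hs := ⟨X.map_mem i p _ hs.1, X.map_mem i _ _ hs.2⟩

/-- A section with invertible germ at a point is invertible near that point. -/
lemma exists_isUnit_of_germ {U : Opens X.carrier} {x : X.carrier} (hx : x ∈ U)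
    (s : X.presheaf.obj (op U)) (h : IsUnit (X.presheaf.germ U x hx s)) :
    ∃ (V : Opens X.carrier) (i : V ⟶ U), x ∈ V ∧ IsUnit (X.presheaf.map i.op s) := by
  obtain ⟨u, hu⟩ := h
  obtain ⟨W, hWU, hW, t, ht⟩ := X.presheaf.exists_le_germ_eq (↑u⁻¹ : X.presheaf.stalk x) hx
  let j : W ⟶ U := homOfLE hWU
  have e1 : X.presheaf.germ W x hW (X.presheaf.map j.op s * t) = X.presheaf.germ W x hW 1 := by
    rw [map_mul, X.presheaf.germ_res_apply, ht, ← hu, map_one, Units.mul_inv]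
  have e2 : X.presheaf.germ W x hW (t * X.presheaf.map j.op s) = X.presheaf.germ W x hW 1 := by
    rw [map_mul, X.presheaf.germ_res_apply, ht, ← hu, map_one, Units.inv_mul]
  obtain ⟨V₁, hV₁, i₁, i₁', h₁⟩ := X.presheaf.germ_eq x hW hW _ _ e1
  obtain ⟨V₂, hV₂, i₂, i₂', h₂⟩ := X.presheaf.germ_eq x hW hW _ _ e2
  have h₁' := congrArg (X.presheaf.map (homOfLE (inf_le_left : V₁ ⊓ V₂ ≤ V₁)).op) h₁
  have h₂' := congrArg (X.presheaf.map (homOfLE (inf_le_right : V₁ ⊓ V₂ ≤ V₂)).op) h₂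
  rw [← ConcreteCategory.comp_apply, ← ConcreteCategory.comp_apply, ← Functor.map_comp,
    ← Functor.map_comp, ← op_comp, ← op_comp, map_mul, map_one] at h₁' h₂'
  let k : V₁ ⊓ V₂ ⟶ W := homOfLE (inf_le_left.trans i₁.le)
  refine ⟨V₁ ⊓ V₂, k ≫ j, ⟨hV₁, hV₂⟩, ?_⟩
  have e3 : X.presheaf.map (k ≫ j).op s = X.presheaf.map k.op (X.presheaf.map j.op s) := by
    rw [op_comp, Functor.map_comp, ConcreteCategory.comp_apply]
  rw [e3]
  exact ⟨⟨_, X.presheaf.map k.op t, h₁', h₂'⟩, rfl⟩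

/-- The zero section `X → 𝔸^{0|1} × X`. -/
def oddLineZero : X.toPresheafedSpace ⟶ X.oddLine.toPresheafedSpace where
  base := 𝟙 X.carrier
  c := { app := fun (U : (Opens X.carrier)ᵒᵖ) => RingCat.ofHom (OddExt.evalZero (X.parity U.unop)) }

/-- The projection `𝔸^{0|1} × X → X`. -/
def oddLineProj : X.oddLine.toPresheafedSpace ⟶ X.toPresheafedSpace where
  base := 𝟙 X.carrier
  c :=
    { app := fun (U : (Opens X.carrier)ᵒᵖ) => RingCat.ofHom (OddExt.incl (X.parity U.unop))
      naturality := fun U V i => by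
        ext s
        exact OddExt.ext rfl (map_zero (X.presheaf.map i).hom).symm }

/-- The morphism `𝔸^{0|1} × 𝔸^{0|1} × X → 𝔸^{0|1} × X` given by addition on `𝔸^{0|1}`. -/
def oddLineAdd : X.oddLine.oddLine.toPresheafedSpace ⟶ X.oddLine.toPresheafedSpace where
  base := 𝟙 X.carrier
  c :=
    { app := fun (U : (Opens X.carrier)ᵒᵖ) => RingCat.ofHom (OddExt.coadd (X.parity U.unop))
      naturality := fun U V i => by
        ext s
        exact OddExt.ext rfl (OddExt.ext rfl (map_zero (X.presheaf.map i).hom).symm) }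

lemma stalkMap_oddLineZero_germ {U : Opens X.carrier} {x : X.carrier} (hx : x ∈ U)
    (s : OddExt (X.parity U)) :
    (X.oddLineZero.stalkMap x).hom (X.oddLine.presheaf.germ U x hx s) =
      X.presheaf.germ U x hx s.re :=
  ConcreteCategory.congr_hom
    (AlgebraicGeometry.PresheafedSpace.stalkMap_germ X.oddLineZero U x hx) s

lemma isUnit_germ_oddLine_iff {U : Opens X.carrier} {x : X.carrier} (hx : x ∈ U)
    (s : OddExt (X.parity U)) :
    IsUnit (X.oddLine.presheaf.germ U x hx s) ↔ IsUnit (X.presheaf.germ U x hx s.re) := by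
  constructor
  · intro h
    have := h.map (X.oddLineZero.stalkMap x).hom
    rw [← X.stalkMap_oddLineZero_germ hx s]
    exact this
  · intro h
    obtain ⟨V, i, hV, hu⟩ := X.exists_isUnit_of_germ hx s.re h
    have h2 : IsUnit (X.oddLineMap i s) := OddExt.isUnit_iff.mpr hu
    have h3 := h2.map (X.oddLine.presheaf.germ V x hV).hom
    have e := X.oddLine.presheaf.germ_res_apply i x hV s
    exact (congrArg IsUnit e).mp h3

lemma isLocalHom_stalkMap_oddLineZero (x : X.carrier) :
    IsLocalHom (X.oddLineZero.stalkMap x).hom where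
  map_nonunit a ha := by
    obtain ⟨U, hU, s, rfl⟩ := X.oddLine.presheaf.exists_germ_eq a
    rw [X.isUnit_germ_oddLine_iff hU s, ← X.stalkMap_oddLineZero_germ hU s]
    exact ha

instance (U : Opens X.carrier) : GradedRing (X.oddLine.parity U) := X.oddLine.graded U

instance (U : Opens X.carrier) : CommRing (evenSubring (X.oddLine.parity U)) :=
  (X.oddLine.supercomm U).commRing

/-- The reduction `(A[ε])₀ → A₀`, `ε ↦ 0`, for `A = O_X(U)`. -/
def evenReduction (U : Opens X.carrier) :
    evenSubring (X.oddLine.parity U) →+* evenSubring (X.parity U) where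
  toFun s := ⟨OddExt.re s.1, s.2.1⟩
  map_one' := rfl
  map_zero' := rfl
  map_add' _ _ := rfl
  map_mul' _ _ := rfl

lemma isHomeomorph_comap_evenReduction (U : Opens X.carrier) :
    IsHomeomorph (PrimeSpectrum.comap (X.evenReduction U)) := by
  refine PrimeSpectrum.isHomeomorph_comap _ (fun a => ⟨1, one_pos, ?_⟩) (fun a ha => ⟨2, ?_⟩)
  · refine ⟨⟨OddExt.incl (X.parity U) a.1, a.2, zero_mem _⟩, ?_⟩
    rw [pow_one]
    rfl
  · have h0 : OddExt.re a.1 = 0 := congrArg Subtype.val ha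
    apply Subtype.ext
    change a.1 ^ 2 = 0
    have : a.1 * a.1 = 0 := by
      refine OddExt.ext ?_ ?_
      · change OddExt.re a.1 * OddExt.re a.1 = 0
        rw [h0, zero_mul]
      · change OddExt.eps a.1 * OddExt.re a.1 +
          SuperRing.parityInvol _ (OddExt.re a.1) * OddExt.eps a.1 = 0
        rw [h0, mul_zero, map_zero, zero_mul, zero_add]
    rw [pow_two, this]

lemma isAffineOpen_oddLine {U : Opens X.carrier} (hU : X.IsAffineOpen U) :
    X.oddLine.IsAffineOpen U where
  exists_homeomorph := by
    obtain ⟨h, hh⟩ := hU.exists_homeomorph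
    refine ⟨h.trans (X.isHomeomorph_comap_evenReduction U).homeomorph, fun x s => ?_⟩
    have := hh x (X.evenReduction U s)
    exact this.trans (not_congr (X.isUnit_germ_oddLine_iff x.2 s.1).symm)
  isLocalization := by
    intro s hs (V : Opens X.carrier) i hV
    have hV' : IsBasicOpen (X := X) (OddExt.re s) V := fun x =>
      (hV x).trans (exists_congr fun hx => X.isUnit_germ_oddLine_iff hx s)
    obtain ⟨h1, h2, h3⟩ := hU.isLocalization (OddExt.re s) hs.1 V i hV'
    exact OddExt.isLocalization (X.supercomm U) (X.supercomm V) (X.presheaf.map i.op).hom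
      (X.map_mem i) s hs.1 h1 h2 h3

end SuperRingedSpace

/-- A superscheme: a superringed space with local stalks which is covered by affine opens. -/
structure Superscheme extends SuperRingedSpace.{u} where
  isLocalRing (x : carrier) : IsLocalRing (presheaf.stalk x)
  exists_isAffineOpen (x : carrier) :
    ∃ U : Opens carrier, x ∈ U ∧ toSuperRingedSpace.IsAffineOpen U

namespace Superscheme

/-- A morphism of superschemes: a morphism of ringed spaces which preserves parity and is local on
stalks. -/
@[ext] structure Hom (X Y : Superscheme.{u}) extends
    AlgebraicGeometry.PresheafedSpace.Hom X.toPresheafedSpace Y.toPresheafedSpace where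
  map_mem (U : Opens Y.carrier) (p : ZMod 2) (s : Y.presheaf.obj (op U)) :
    s ∈ Y.parity U p → c.app (op U) s ∈ X.parity ((Opens.map base).obj U) p
  isLocalHom (x : X.carrier) : IsLocalHom (toHom.stalkMap x).hom

instance : Category Superscheme.{u} where
  Hom := Hom
  id X :=
    { toHom := 𝟙 X.toPresheafedSpace
      map_mem := fun U p s hs => hs
      isLocalHom := fun x => by
        rw [AlgebraicGeometry.PresheafedSpace.stalkMap.id]
        exact ⟨fun a ha => ha⟩ }
  comp {X Y Z} f g :=
    { toHom := (f.toHom ≫ g.toHom : X.toPresheafedSpace ⟶ Z.toPresheafedSpace)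
      map_mem := fun U p s hs => f.map_mem _ p _ (g.map_mem U p s hs)
      isLocalHom := fun x => by
        rw [AlgebraicGeometry.PresheafedSpace.stalkMap.comp]
        have h1 := f.isLocalHom x
        have h2 := g.isLocalHom (f.base x)
        exact ⟨fun a ha => h2.map_nonunit a (h1.map_nonunit _ ha)⟩ }

end Superscheme

namespace Superscheme

variable {X Y S : Superscheme.{u}}

/-- Locality on stalks in terms of sections. -/
lemma isLocalHom_stalkMap_of {Z W : SuperRingedSpace.{u}}
    (φ : Z.toPresheafedSpace ⟶ W.toPresheafedSpace) (x : Z.carrier)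
    (h : ∀ (U : Opens W.carrier) (hx : φ.base x ∈ U) (s : W.presheaf.obj (op U)),
      IsUnit (Z.presheaf.germ ((Opens.map φ.base).obj U) x hx (φ.c.app (op U) s)) →
        IsUnit (W.presheaf.germ U (φ.base x) hx s)) :
    IsLocalHom (φ.stalkMap x).hom where
  map_nonunit a ha := by
    obtain ⟨U, hU, s, rfl⟩ := W.presheaf.exists_germ_eq a
    have e := ConcreteCategory.congr_hom
      (AlgebraicGeometry.PresheafedSpace.stalkMap_germ φ U x hU) s
    exact h U hU s ((congrArg IsUnit e).mp ha)

variable (X) in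
/-- The superscheme `𝔸^{0|1}_S ×_S X = 𝔸^{0|1} × X = (|X|, O_X[ε])`, for a superscheme `X` over any base
`S`. -/
def oddLine : Superscheme.{u} where
  toSuperRingedSpace := X.toSuperRingedSpace.oddLine
  isLocalRing (x : X.carrier) := by
    have := X.isLocalRing x
    have := X.toSuperRingedSpace.isLocalHom_stalkMap_oddLineZero x
    exact @RingHom.domain_isLocalRing _ (X.presheaf.stalk x) _ _ _
      (X.toSuperRingedSpace.oddLineZero.stalkMap x).hom this
  exists_isAffineOpen (x : X.carrier) := by
    obtain ⟨U, hx, hU⟩ := X.exists_isAffineOpen x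
    exact ⟨U, hx, X.isAffineOpen_oddLine hU⟩

variable (X) in
/-- The projection `𝔸^{0|1} × X → X`, `f ↦ f`. -/
def oddLineProj : X.oddLine ⟶ X where
  toHom := X.toSuperRingedSpace.oddLineProj
  map_mem _ _ _ hs := ⟨hs, zero_mem _⟩
  isLocalHom x := isLocalHom_stalkMap_of _ x fun U hx s h =>
    (X.isUnit_germ_oddLine_iff (U := U) hx (OddExt.incl (X.parity U) s)).mp h

variable (X) in
/-- The zero section `X → 𝔸^{0|1} × X`, `f + ε g ↦ f`. -/
def oddLineZero : X ⟶ X.oddLine where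
  toHom := X.toSuperRingedSpace.oddLineZero
  map_mem _ _ _ hs := hs.1
  isLocalHom x := X.isLocalHom_stalkMap_oddLineZero x

variable (X) in
/-- The morphism `𝔸^{0|1} × 𝔸^{0|1} × X → 𝔸^{0|1} × X`, `(g, h, x) ↦ (g + h, x)`, i.e. `ε ↦ ε₁ + ε₂`. -/
def oddLineAdd : X.oddLine.oddLine ⟶ X.oddLine where
  toHom := X.toSuperRingedSpace.oddLineAdd
  map_mem _ _ _ hs := ⟨hs, hs.2, zero_mem _⟩
  isLocalHom x := isLocalHom_stalkMap_of _ x fun (U : Opens X.carrier) hx s h =>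
    (X.isUnit_germ_oddLine_iff (U := U) hx s).mpr <|
      (X.isUnit_germ_oddLine_iff (U := U) hx s).mp <|
        (X.oddLine.isUnit_germ_oddLine_iff (U := U) hx (OddExt.coadd (X.parity U) s)).mp h

/-- The morphism `id × f : 𝔸^{0|1} × X → 𝔸^{0|1} × Y` for `f : X → Y`. -/
def oddLineMap (f : X ⟶ Y) : X.oddLine ⟶ Y.oddLine where
  base := f.base
  c :=
    { app := fun (U : (Opens Y.carrier)ᵒᵖ) =>
        RingCat.ofHom (OddExt.map (f.c.app U).hom (f.map_mem U.unop))
      naturality := fun (U V : (Opens Y.carrier)ᵒᵖ) i => by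
        ext s
        exact OddExt.ext (ConcreteCategory.congr_hom (f.c.naturality i) (OddExt.re s))
          (ConcreteCategory.congr_hom (f.c.naturality i) (OddExt.eps s)) }
  map_mem U p s hs := ⟨f.map_mem U p _ hs.1, f.map_mem U _ _ hs.2⟩
  isLocalHom x := isLocalHom_stalkMap_of _ x fun (U : Opens Y.carrier) hx s h => by
    refine (Y.isUnit_germ_oddLine_iff (U := U) hx s).mpr ?_
    let V : Opens X.carrier := (Opens.map f.base).obj U
    have h' := (X.isUnit_germ_oddLine_iff (U := V) hx
      (OddExt.map (ℬ := X.parity V) (f.c.app (op U)).hom (f.map_mem U) s)).mp h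
    have e := ConcreteCategory.congr_hom
      (AlgebraicGeometry.PresheafedSpace.stalkMap_germ f.toHom U x hx) (OddExt.re s)
    exact (f.isLocalHom x).map_nonunit _ ((congrArg IsUnit e).mpr h')

/-- A closed embedding of superschemes. -/
structure IsClosedEmbedding (f : X ⟶ Y) : Prop where
  base : Topology.IsClosedEmbedding f.base
  stalkMap_surjective (x : X.carrier) : Function.Surjective (f.toHom.stalkMap x).hom

/-- A locally closed embedding of superschemes. -/
structure IsLocallyClosedEmbedding (f : X ⟶ Y) : Prop where
  base : Topology.IsEmbedding f.base
  isLocallyClosed_range : IsLocallyClosed (Set.range f.base)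
  stalkMap_surjective (x : X.carrier) : Function.Surjective (f.toHom.stalkMap x).hom

/-- `X` is separated over `S`: the diagonal `X → X ×_S X` is a closed embedding. -/
def IsSeparated {f : X ⟶ S} {P : Superscheme.{u}} {p₁ p₂ : P ⟶ X} (hP : IsPullback p₁ p₂ f f) : Prop :=
  IsClosedEmbedding (hP.lift (𝟙 X) (𝟙 X) rfl)

end Superscheme

/-- An action `𝔸^{0|1}_S ×_S X → X` over `S` of the additive group `𝔸^{0|1}_S` on a superscheme `X` over
`S`. -/
structure OddLineAction {X S : Superscheme.{u}} (f : X ⟶ S) where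
  /-- the action morphism `(g, x) ↦ g x` -/
  act : X.oddLine ⟶ X
  act_over : act ≫ f = X.oddLineProj ≫ f
  zero_act : X.oddLineZero ≫ act = 𝟙 X
  /-- `(g + h) x = g (h x)` -/
  add_act : X.oddLineAdd ≫ act = Superscheme.oddLineMap act ≫ act

namespace OddLineAction

variable {X S P : Superscheme.{u}} {f : X ⟶ S} (σ : OddLineAction f)

/-- An action is the identity on points. -/
lemma base_apply (x : X.carrier) : σ.act.base x = x :=
  congrArg (fun g : X ⟶ X => g.base x) σ.zero_act

lemma le_preimage (U : Opens X.carrier) : U ≤ (Opens.map σ.act.base).obj U := fun x hx =>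
  show σ.act.base x ∈ U by rwa [σ.base_apply]

/-- The homological vector field `v` of an action, determined by `σ^*(s) = s + ε v(s)`. -/
def vectorField {U : Opens X.carrier} (s : X.presheaf.obj (op U)) : X.presheaf.obj (op U) :=
  X.presheaf.map (homOfLE (σ.le_preimage U)).op (OddExt.eps (σ.act.c.app (op U) s))

/-- The morphism `𝔸^{0|1}_S ×_S X → X ×_S X`, `(g, x) ↦ (g x, x)`. -/
noncomputable def shear {p₁ p₂ : P ⟶ X} (hP : IsPullback p₁ p₂ f f) : X.oddLine ⟶ P :=
  hP.lift σ.act X.oddLineProj σ.act_over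

/-- The action is free: `(g, x) ↦ (g x, x)` is a closed embedding into `X ×_S X`. -/
def IsFree {p₁ p₂ : P ⟶ X} (hP : IsPullback p₁ p₂ f f) : Prop :=
  Superscheme.IsClosedEmbedding (σ.shear hP)

/-- Locally there are functions `a_i`, `b_i` of opposite parity with `∑ a_i v(b_i) = 1`. -/
def LocallySumEqOne : Prop :=
  ∀ x : X.carrier, ∃ U : Opens X.carrier, x ∈ U ∧
    ∃ (n : ℕ) (p : Fin n → ZMod 2) (a b : Fin n → X.presheaf.obj (op U)),
      (∀ i, a i ∈ X.parity U (p i) ∧ b i ∈ X.parity U (p i + 1)) ∧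
      ∑ i, a i * σ.vectorField (b i) = 1

/-- Locally there is an odd function `θ` with `v(θ)` invertible. -/
def LocallyExistsIsUnit : Prop :=
  ∀ x : X.carrier, ∃ U : Opens X.carrier, x ∈ U ∧
    ∃ θ ∈ X.parity U 1, IsUnit (σ.vectorField θ)

/-- Locally there is an odd function `θ` with `v(θ) = 1`. -/
def LocallyExistsEqOne : Prop :=
  ∀ x : X.carrier, ∃ U : Opens X.carrier, x ∈ U ∧
    ∃ θ ∈ X.parity U 1, σ.vectorField θ = 1

/-- The kernel and the image of `v : O_X → O_X` are the same subsheaf of `O_X`. -/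
def KerEqImage : Prop :=
  ∀ (U : Opens X.carrier) (s : X.presheaf.obj (op U)),
    σ.vectorField s = 0 ↔
      ∀ x ∈ U, ∃ (V : Opens X.carrier) (i : V ⟶ U), x ∈ V ∧
        ∃ t : X.presheaf.obj (op V), σ.vectorField t = X.presheaf.map i.op s

end OddLineAction

/-!
Let `v` be the vector field of the action, so that `σ^*(s) = s + ε v(s)`. It is an odd derivation
with `v² = 0`.

The conditions on functions are compared directly. Stalks are local and odd functions square to
zero, so if `∑ aᵢ v(bᵢ) = 1` then at each point some `v(bᵢ)` with `bᵢ` odd is invertible. The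
inverse of `v(θ)` is killed by `v`, so dividing `θ` by `v(θ)` gives `v(θ) = 1`. Multiplication by
such a `θ` is a contracting homotopy, hence the kernel of `v` is its image; conversely `v(1) = 0`
makes `1` an element of the image.

For the shear morphism `𝔸^{0|1} × X → X ×_S X`, the fibre product enters only through its universal
property, tested on `Spec k` and on `Spec k[ε]` for fields `k`.

* On points the shear morphism is the diagonal (`OddLineAction.shear_base_eq`), because the zero
  section is the identity on points. The diagonal has a retraction, so it is an embedding, and a
  point `w` of `X ×_S X` lies on it exactly when `Spec κ(w) → X ×_S X` has equal projections to
  `X`. Over an affine open of `X` this is a closed condition, so the image of the diagonal is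
  locally closed (`Superscheme.isLocallyClosed_range_diagonal`). If `X` is separated, the image is
  closed by assumption.
* It remains to see that surjectivity on stalks is equivalent to the conditions on functions
  (`OddLineAction.shear_stalkMap_surjective_iff`). If `v(θ) = 1` locally, then
  `ε = p₁^* θ - p₂^* θ`. If instead all `v(s)` vanish at a point `x` with residue field `k`, then
  the composition `Spec k[ε] → 𝔸^{0|1} × X → X ×_S X` has equal projections to `X`, so it factors
  through `Spec k`, and `ε` is not in the image of the stalk of `X ×_S X`.
-/

/-! ### Local rings and supercommutative rings -/

namespace IsLocalRing

variable {R : Type u} [Ring R] [IsLocalRing R]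

/-- A left invertible element of a local ring is a unit: for `b * a = 1` the element `a * b` is
idempotent, and an idempotent of a local ring is `0` or `1`. -/
lemma isUnit_of_mul_eq_one_left {a b : R} (h : b * a = 1) : IsUnit a := by
  have e : a * b * (a * b) = a * b := by rw [mul_assoc, ← mul_assoc b, h, one_mul]
  rcases isUnit_or_isUnit_of_add_one (add_sub_cancel (a * b) 1) with h1 | h1
  · have h2 : a * b = 1 := h1.mul_left_cancel (by rw [e, mul_one])
    exact ⟨⟨a, b, h2, h⟩, rfl⟩
  · have h2 : a * b = 0 := h1.mul_right_cancel (by rw [mul_sub, e]; simp)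
    have h3 : a = 0 := by rw [← mul_one a, ← h, ← mul_assoc, h2, zero_mul]
    rw [h3, mul_zero] at h
    exact absurd h zero_ne_one

lemma isUnit_of_isUnit_mul_left {a b : R} (h : IsUnit (b * a)) : IsUnit a := by
  obtain ⟨c, hc⟩ := h.exists_left_inv
  exact isUnit_of_mul_eq_one_left (b := c * b) (by rw [mul_assoc, hc])

lemma isUnit_of_isUnit_mul_right {a b : R} (h : IsUnit (a * b)) : IsUnit a := by
  obtain ⟨c, hc⟩ := h.exists_right_inv
  rw [mul_assoc] at hc
  obtain ⟨u, hu⟩ := isUnit_of_mul_eq_one_left hc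
  exact ⟨⟨a, b * c, hc, by
    rw [← hu] at hc ⊢
    rw [← Units.inv_eq_of_mul_eq_one_left hc]
    simp⟩, rfl⟩

variable (R) in
/-- The two-sided ideal of nonunits of a local ring that need not be commutative. -/
def nonunitsIdeal : Ideal R where
  carrier := nonunits R
  add_mem' := nonunits_add
  zero_mem' := not_isUnit_zero
  smul_mem' _ _ hx h := hx (isUnit_of_isUnit_mul_left h)

instance : (nonunitsIdeal R).IsTwoSided where
  mul_mem_of_left _ hx h := hx (isUnit_of_isUnit_mul_right h)

/-- The residue field of a local ring that is commutative up to nonunits. -/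
lemma exists_field_of_commutator (hR : ∀ a b : R, ¬ IsUnit (a * b - b * a)) :
    ∃ (k : Type u) (_ : Field k) (φ : R →+* k), ∀ a, φ a ≠ 0 ↔ IsUnit a := by
  have hφ : ∀ a, Ideal.Quotient.mk (nonunitsIdeal R) a ≠ 0 ↔ IsUnit a := fun a => by
    rw [Ne, Ideal.Quotient.eq_zero_iff_mem]
    exact not_not
  let _ : CommRing (R ⧸ nonunitsIdeal R) :=
    { Ideal.Quotient.ring (nonunitsIdeal R) with
      mul_comm := by
        intro a b
        obtain ⟨a, rfl⟩ := Ideal.Quotient.mk_surjective a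
        obtain ⟨b, rfl⟩ := Ideal.Quotient.mk_surjective b
        exact Ideal.Quotient.eq.mpr (hR a b) }
  have hk : IsField (R ⧸ nonunitsIdeal R) :=
    { exists_pair_ne := ⟨Ideal.Quotient.mk _ 1, 0, (hφ 1).mpr isUnit_one⟩
      mul_comm := mul_comm
      mul_inv_cancel := by
        intro a ha
        obtain ⟨a, rfl⟩ := Ideal.Quotient.mk_surjective a
        obtain ⟨b, hb⟩ := ((hφ a).mp ha).exists_right_inv
        exact ⟨Ideal.Quotient.mk _ b, by rw [← map_mul, hb, map_one]⟩ }
  exact ⟨_, hk.toField, Ideal.Quotient.mk (nonunitsIdeal R), hφ⟩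

end IsLocalRing

lemma not_isUnit_of_mul_self_eq_zero {R : Type u} [Ring R] [Nontrivial R] {a : R}
    (h : a * a = 0) : ¬ IsUnit a := fun ha =>
  not_isUnit_zero (h ▸ ha.mul ha)

namespace IsSupercommutative

open GradedRing SuperRing

variable {A : Type u} [Ring A] {𝒜 : ZMod 2 → AddSubgroup A}

lemma odd_mul_odd (h : IsSupercommutative 𝒜) {a b : A} (ha : a ∈ 𝒜 1) (hb : b ∈ 𝒜 1) :
    a * b = -(b * a) := by
  simpa [ZMod.val_one] using h.comm ha hb

lemma commutator_mul_self [GradedRing 𝒜] (h : IsSupercommutative 𝒜) (a b : A) :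
    (a * b - b * a) * (a * b - b * a) = 0 := by
  rw [← proj_zero_add_proj_one 𝒜 a, ← proj_zero_add_proj_one 𝒜 b]
  have a0 := h.even_comm (proj_mem 𝒜 0 a)
  have b0 := h.even_comm (proj_mem 𝒜 0 b)
  have h1 := h.odd_mul_odd (proj_mem 𝒜 1 b) (proj_mem 𝒜 1 a)
  have h2 := h.odd_mul_self (proj_mem 𝒜 1 a)
  generalize proj 𝒜 0 a = a₀ at *
  generalize proj 𝒜 1 a = a₁ at *
  generalize proj 𝒜 0 b = b₀ at *
  generalize proj 𝒜 1 b = b₁ at *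
  have e : (a₀ + a₁) * (b₀ + b₁) - (b₀ + b₁) * (a₀ + a₁) = a₁ * b₁ + a₁ * b₁ := by
    simp only [mul_add, add_mul, h1, a0 b₀, a0 b₁, b0 a₁]
    abel
  have e' : a₁ * b₁ * (a₁ * b₁) = 0 := by
    rw [mul_assoc, ← mul_assoc b₁, h1, neg_mul, mul_assoc a₁ b₁, mul_neg, ← mul_assoc, h2,
      zero_mul, neg_zero]
  rw [e, add_mul, mul_add, e']
  simp

end IsSupercommutative

/-! ### Sections and morphisms of superschemes -/

namespace SuperRingedSpace

variable (X : SuperRingedSpace.{u})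

lemma section_ext {U : Opens X.carrier} {s t : X.presheaf.obj (op U)}
    (h : ∀ x ∈ U, ∃ (V : Opens X.carrier) (i : V ⟶ U), x ∈ V ∧
      X.presheaf.map i.op s = X.presheaf.map i.op t) : s = t := by
  refine TopCat.Presheaf.section_ext ⟨X.presheaf, X.IsSheaf⟩ U s t fun x hx => ?_
  obtain ⟨V, i, hV, e⟩ := h x hx
  change X.presheaf.germ U x hx s = X.presheaf.germ U x hx t
  rw [← X.presheaf.germ_res_apply i x hV s, e, X.presheaf.germ_res_apply]

variable {X} in
lemma map_map {U V W : Opens X.carrier} (i : V ⟶ U) (j : W ⟶ V) (k : W ⟶ U)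
    (s : X.presheaf.obj (op U)) :
    X.presheaf.map j.op (X.presheaf.map i.op s) = X.presheaf.map k.op s := by
  rw [Subsingleton.elim k (j ≫ i), op_comp, Functor.map_comp, ConcreteCategory.comp_apply]

lemma map_self {U : Opens X.carrier} (i : U ⟶ U) (s : X.presheaf.obj (op U)) :
    X.presheaf.map i.op s = s := by
  rw [Subsingleton.elim i (𝟙 U), op_id, CategoryTheory.Functor.map_id]
  rfl

end SuperRingedSpace

namespace Superscheme

variable {X Y Z : Superscheme.{u}}

lemma isLocalRing_stalk (X : Superscheme.{u}) (x : X.carrier) :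
    IsLocalRing (X.presheaf.stalk x) := X.isLocalRing x

/-- A morphism of superschemes is determined by its map on points and by the pullback of
sections. -/
lemma hom_ext_of_sections {f g : X ⟶ Y} (hb : f.base = g.base)
    (h : ∀ (U : Opens Y.carrier) (s : Y.presheaf.obj (op U))
      (i : (Opens.map f.base).obj U ⟶ (Opens.map g.base).obj U),
      f.c.app (op U) s = X.presheaf.map i.op (g.c.app (op U) s)) : f = g := by
  obtain ⟨⟨fb, fc⟩, _, _⟩ := f
  obtain ⟨⟨gb, gc⟩, _, _⟩ := g
  obtain rfl : fb = gb := hb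
  have : fc = gc := by
    ext U s
    exact (h U s (𝟙 _)).trans (X.map_self _ _)
  subst this
  rfl

lemma map_app_congr {f g : X ⟶ Y} (h : f = g) {U : Opens Y.carrier} (s : Y.presheaf.obj (op U))
    {V : Opens X.carrier} (i : V ⟶ (Opens.map f.base).obj U)
    (j : V ⟶ (Opens.map g.base).obj U) :
    X.presheaf.map i.op (f.c.app (op U) s) = X.presheaf.map j.op (g.c.app (op U) s) := by
  subst h
  rw [Subsingleton.elim i j]

lemma app_map (f : X ⟶ Y) {U V : Opens Y.carrier} (i : V ⟶ U) (s : Y.presheaf.obj (op U)) :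
    f.c.app (op V) (Y.presheaf.map i.op s) =
      X.presheaf.map ((Opens.map f.base).map i).op (f.c.app (op U) s) :=
  ConcreteCategory.congr_hom (f.c.naturality i.op) s

lemma stalkMap_germ (f : X ⟶ Y) {U : Opens Y.carrier} (x : X.carrier) (hx : f.base x ∈ U)
    (s : Y.presheaf.obj (op U)) :
    (f.toHom.stalkMap x).hom (Y.presheaf.germ U (f.base x) hx s) =
      X.presheaf.germ ((Opens.map f.base).obj U) x hx (f.c.app (op U) s) :=
  ConcreteCategory.congr_hom (AlgebraicGeometry.PresheafedSpace.stalkMap_germ f.toHom U x hx) s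

lemma stalkMap_germ_comp {f : X ⟶ Y} {g : Y ⟶ Z} {h : X ⟶ Z} (e : f ≫ g = h)
    {U : Opens Z.carrier} (x : X.carrier) (hx : g.base (f.base x) ∈ U) (hx' : h.base x ∈ U)
    (s : Z.presheaf.obj (op U)) :
    (f.toHom.stalkMap x).hom
        (Y.presheaf.germ ((Opens.map g.base).obj U) (f.base x) hx (g.c.app (op U) s)) =
      X.presheaf.germ ((Opens.map h.base).obj U) x hx' (h.c.app (op U) s) := by
  subst e
  exact stalkMap_germ f x hx _

lemma exists_germ_oddLine_eq {x : X.carrier} (z : X.oddLine.presheaf.stalk x)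
    {V : Opens X.carrier} (hV : x ∈ V) :
    ∃ (U : Opens X.carrier) (_ : U ≤ V) (hU : x ∈ U) (a b : X.presheaf.obj (op U)),
      X.oddLine.presheaf.germ U x hU (⟨a, b⟩ : OddExt (X.parity U)) = z := by
  obtain ⟨U, hUV, hU, ⟨a, b⟩, h⟩ := X.oddLine.presheaf.exists_le_germ_eq z hV
  exact ⟨U, hUV, hU, a, b, h⟩

lemma isUnit_germ_app_iff (f : X ⟶ Y) {U : Opens Y.carrier} (x : X.carrier) (hx : f.base x ∈ U)
    (s : Y.presheaf.obj (op U)) :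
    IsUnit (X.presheaf.germ ((Opens.map f.base).obj U) x hx (f.c.app (op U) s)) ↔
      IsUnit (Y.presheaf.germ U (f.base x) hx s) := by
  rw [← stalkMap_germ]
  exact ⟨fun h => (f.isLocalHom x).map_nonunit _ h, fun h => h.map _⟩

/-- Odd functions square to zero, hence vanish in the residue fields. -/
lemma not_isUnit_germ_odd {U : Opens X.carrier} {x : X.carrier} (hx : x ∈ U)
    {s : X.presheaf.obj (op U)} (hs : s ∈ X.parity U 1) :
    ¬ IsUnit (X.presheaf.germ U x hx s) := by
  have := X.isLocalRing_stalk x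
  apply not_isUnit_of_mul_self_eq_zero
  rw [← map_mul, (X.supercomm U).odd_mul_self hs, map_zero]

/-- The residue field of a superscheme at a point. It is purely even, since odd functions
are nilpotent. -/
lemma exists_residueField (X : Superscheme.{u}) (x : X.carrier) :
    ∃ (k : Type u) (_ : Field k) (φ : X.presheaf.stalk x →+* k), ∀ a, φ a ≠ 0 ↔ IsUnit a := by
  have := X.isLocalRing_stalk x
  refine IsLocalRing.exists_field_of_commutator fun a b => not_isUnit_of_mul_self_eq_zero ?_
  obtain ⟨U, hU, s, rfl⟩ := X.presheaf.exists_germ_eq a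
  obtain ⟨V, hVU, hV, t, rfl⟩ := X.presheaf.exists_le_germ_eq b hU
  rw [← X.presheaf.germ_res_apply (homOfLE hVU) x hV s]
  erw [← map_mul, ← map_mul, ← map_sub, ← map_mul, (X.supercomm V).commutator_mul_self, map_zero]

end Superscheme

/-! ### The spectrum of a field and its points in a superscheme -/

section PurelyEven

variable (A : Type u) [CommRing A]

/-- The grading of a commutative ring for which all elements are even. -/
def purelyEven (i : ZMod 2) : AddSubgroup A where
  carrier := {a | i ≠ 0 → a = 0}
  add_mem' ha hb hi := by rw [ha hi, hb hi, add_zero]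
  zero_mem' _ := rfl
  neg_mem' ha hi := by rw [ha hi, neg_zero]

variable {A}

lemma mem_purelyEven_zero (a : A) : a ∈ purelyEven A 0 := fun h => absurd rfl h

lemma eq_zero_of_mem_purelyEven_one {a : A} (h : a ∈ purelyEven A 1) : a = 0 := h (by decide)

variable (A) in
/-- The inclusion of a purely even ring as its component of degree `0`. -/
def toPurelyEvenZero : A →+ purelyEven A 0 where
  toFun a := ⟨a, mem_purelyEven_zero a⟩
  map_zero' := rfl
  map_add' _ _ := rfl

instance purelyEven.gradedRing : GradedRing (purelyEven A) where
  one_mem := mem_purelyEven_zero 1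
  mul_mem i j a b ha hb hij := by
    by_cases hi : i = 0
    · have hj : j ≠ 0 := fun hj => hij (by rw [hi, hj, add_zero])
      rw [hb hj, mul_zero]
    · rw [ha hi, zero_mul]
  toDecomposition := DirectSum.Decomposition.ofAddHom (ℳ := purelyEven A)
    ((DirectSum.of (fun i => purelyEven A i) 0).comp (toPurelyEvenZero A))
    (by ext a; simp [toPurelyEvenZero])
    (by
      ext i x : 2
      obtain rfl | rfl := SuperRing.zero_or_one i
      · simp [toPurelyEvenZero]
      · have : x = 0 := Subtype.ext (eq_zero_of_mem_purelyEven_one x.2)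
        simp [this])

lemma isSupercommutative_purelyEven : IsSupercommutative (purelyEven A) where
  comm {i j a b} ha hb := by
    by_cases hi : i = 0
    · simp [hi, mul_comm]
    · simp [ha hi]
  odd_mul_self ha := by rw [eq_zero_of_mem_purelyEven_one ha, zero_mul]

end PurelyEven

namespace SuperRingedSpace

variable (k : Type u) [Field k]

/-- The one-point superringed space with the purely even field `k` as its ring of functions.
The sections over an open `V` are encoded as the functions `V → k`. -/
def ofField : SuperRingedSpace.{u} where
  carrier := TopCat.of PUnit.{u + 1}
  presheaf :=
    { obj := fun U => RingCat.of (U.unop → k)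
      map := fun {U V} i => RingCat.ofHom
        { toFun := fun s y => s ⟨y.1, i.unop.le y.2⟩
          map_one' := rfl
          map_zero' := rfl
          map_add' := fun _ _ => rfl
          map_mul' := fun _ _ => rfl } }
  IsSheaf := by
    rw [TopCat.Presheaf.isSheaf_iff_isSheafUniqueGluing]
    intro ι U sf hsf
    have hU : ∀ y : (iSup U : Opens (TopCat.of PUnit.{u + 1})), ∃ i, y.1 ∈ U i := fun y =>
      Opens.mem_iSup.mp y.2
    choose j hj using hU
    refine ⟨fun y => sf (j y) ⟨y.1, hj y⟩, fun i => ?_, fun t ht => ?_⟩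
    · funext y
      have hy : y.1 ∈ iSup U := Opens.mem_iSup.mpr ⟨i, y.2⟩
      exact congrFun (hsf (j ⟨y.1, hy⟩) i) ⟨y.1, hj ⟨y.1, hy⟩, y.2⟩
    · funext y
      exact congrFun (ht (j y)) ⟨y.1, hj y⟩
  parity U := purelyEven (U → k)
  graded _ := purelyEven.gradedRing
  supercomm U := isSupercommutative_purelyEven
  map_mem i p s hs hp := by
    rw [hs hp]
    rfl

variable {k}

lemma ofField_germ_eq {U V : Opens PUnit.{u + 1}} {y : PUnit.{u + 1}} (hU : y ∈ U) (hV : y ∈ V)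
    {s : U → k} {t : V → k}
    (h : (ofField k).presheaf.germ U y hU s = (ofField k).presheaf.germ V y hV t) :
    s ⟨y, hU⟩ = t ⟨y, hV⟩ := by
  obtain ⟨W, hW, i, j, e⟩ := (ofField k).presheaf.germ_eq y hU hV s t h
  exact congrFun e ⟨y, hW⟩

lemma isUnit_ofField_section {U : Opens PUnit.{u + 1}} {s : U → k} (h : ∀ y, s y ≠ 0) :
    IsUnit s :=
  Pi.isUnit_iff.mpr fun y => (h y).isUnit

lemma isUnit_germ_ofField_iff {U : Opens PUnit.{u + 1}} {y : PUnit.{u + 1}} (hU : y ∈ U)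
    {s : U → k} : IsUnit ((ofField k).presheaf.germ U y hU s) ↔ s ⟨y, hU⟩ ≠ 0 := by
  constructor
  · intro h h0
    obtain ⟨b, hb⟩ := h.exists_right_inv
    obtain ⟨V, hVU, hV, t, rfl⟩ := (ofField k).presheaf.exists_le_germ_eq b hU
    rw [← (ofField k).presheaf.germ_res_apply (homOfLE hVU) y hV s] at hb
    erw [← map_mul, ← map_one ((ofField k).presheaf.germ V y hV).hom] at hb
    have := ofField_germ_eq hV hV hb
    change s ⟨y, _⟩ * t ⟨y, _⟩ = 1 at this
    rw [h0, zero_mul] at this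
    exact zero_ne_one this
  · intro h
    exact (isUnit_ofField_section (s := s) fun z => h).map
      ((ofField k).presheaf.germ U y hU).hom

lemma isAffineOpen_ofField : (ofField k).IsAffineOpen ⊤ where
  exists_homeomorph := by
    let E := evenSubring (purelyEven ((⊤ : Opens PUnit.{u + 1}) → k))
    let _ : CommRing E := isSupercommutative_purelyEven.commRing
    let y₀ : (⊤ : Opens PUnit.{u + 1}) := ⟨PUnit.unit, trivial⟩
    let ev : E →+* k := (Pi.evalRingHom (fun _ : (⊤ : Opens PUnit.{u + 1}) => k) y₀).comp
      (evenSubring (purelyEven ((⊤ : Opens PUnit.{u + 1}) → k))).subtype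
    have hE : ∀ (p : PrimeSpectrum E) (s : E), s ∈ p.asIdeal ↔ ev s = 0 := by
      intro p s
      constructor
      · intro hs
        by_contra h
        refine p.2.ne_top (Ideal.eq_top_of_isUnit_mem _ hs ?_)
        let t : E := ⟨fun _ => (ev s)⁻¹, mem_purelyEven_zero _⟩
        refine IsUnit.of_mul_eq_one t (Subtype.ext (funext fun y => ?_))
        exact mul_inv_cancel₀ h
      · intro hs
        have : s = 0 := Subtype.ext (funext fun y => hs)
        rw [this]
        exact zero_mem _
    let p₀ : PrimeSpectrum E := ⟨RingHom.ker ev, RingHom.ker_isPrime ev⟩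
    let _ : Unique (PrimeSpectrum E) :=
      ⟨⟨p₀⟩, fun p => PrimeSpectrum.ext (Ideal.ext fun s => (hE p s).trans (hE p₀ s).symm)⟩
    let _ : Unique (⊤ : Opens PUnit.{u + 1}) := ⟨⟨y₀⟩, fun _ => rfl⟩
    refine ⟨Homeomorph.homeomorphOfUnique (⊤ : Opens PUnit.{u + 1}) (PrimeSpectrum E),
      fun x s => ?_⟩
    have h1 := hE (Homeomorph.homeomorphOfUnique (⊤ : Opens PUnit.{u + 1}) (PrimeSpectrum E) x) s
    have h2 := isUnit_germ_ofField_iff (k := k) (U := ⊤) (y := x.1) x.2 (s := s.1)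
    exact h1.trans (not_not.symm.trans (not_congr h2.symm))
  isLocalization := by
    classical
    intro (s : (⊤ : Opens PUnit.{u + 1}) → k) _ (V : Opens PUnit.{u + 1}) i hV
    have hV' : ∀ y, y ∈ V ↔ s ⟨y, trivial⟩ ≠ 0 := fun y =>
      (hV y).trans ⟨fun ⟨hy, h⟩ => (isUnit_germ_ofField_iff hy).mp h,
        fun h => ⟨trivial, (isUnit_germ_ofField_iff (U := ⊤) trivial).mpr h⟩⟩
    refine ⟨isUnit_ofField_section fun y => (hV' y.1).mp y.2, fun (t : V → k) => ?_,
      fun (a : (⊤ : Opens PUnit.{u + 1}) → k) ha => ?_⟩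
    · let a : (⊤ : Opens PUnit.{u + 1}) → k := fun y => if h : y.1 ∈ V then t ⟨y.1, h⟩ else 0
      refine ⟨0, a, ?_⟩
      refine (congrArg (· * t) (pow_zero _)).trans ((one_mul t).trans (funext fun y => ?_))
      exact (dif_pos y.2 : a ⟨y.1, trivial⟩ = _).symm
    · refine ⟨1, ?_⟩
      have : s * a = 0 := funext fun y => by
        by_cases h : y.1 ∈ V
        · have h0 : a y = 0 := congrFun ha ⟨y.1, h⟩
          rw [Pi.mul_apply, h0, mul_zero, Pi.zero_apply]
        · have h0 : s y = 0 := not_not.mp fun h0 => h ((hV' y.1).mpr h0)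
          rw [Pi.mul_apply, h0, zero_mul, Pi.zero_apply]
      exact (congrArg (· * a) (pow_one s)).trans this

end SuperRingedSpace

namespace Superscheme

open SuperRingedSpace

variable (k : Type u) [Field k]

/-- The spectrum of a field, as a purely even superscheme. -/
def ofField : Superscheme.{u} where
  toSuperRingedSpace := SuperRingedSpace.ofField k
  isLocalRing (x : PUnit.{u + 1}) := by
    have hn : Nontrivial ((SuperRingedSpace.ofField k).presheaf.stalk x) := by
      refine ⟨1, 0, fun h => ?_⟩
      rw [← map_one ((SuperRingedSpace.ofField k).presheaf.germ ⊤ x trivial).hom,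
        ← map_zero ((SuperRingedSpace.ofField k).presheaf.germ ⊤ x trivial).hom] at h
      exact one_ne_zero (ofField_germ_eq (U := ⊤) (V := ⊤) trivial trivial h)
    refine ⟨fun {a b} hab => ?_⟩
    obtain ⟨U, hU, s, rfl⟩ := (SuperRingedSpace.ofField k).presheaf.exists_germ_eq a
    obtain ⟨V, hVU, hV, t, rfl⟩ := (SuperRingedSpace.ofField k).presheaf.exists_le_germ_eq b hU
    rw [← (SuperRingedSpace.ofField k).presheaf.germ_res_apply (homOfLE hVU) x hV s] at hab ⊢
    erw [← map_add, ← map_one ((SuperRingedSpace.ofField k).presheaf.germ V x hV).hom] at hab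
    let s' : U → k := s
    let t' : V → k := t
    have h : s' ⟨x, hU⟩ + t' ⟨x, hV⟩ = 1 := ofField_germ_eq (U := V) (V := V) hV hV hab
    by_cases h1 : s' ⟨x, hU⟩ = 0
    · refine Or.inr ((isUnit_germ_ofField_iff (U := V) hV (s := t')).mpr fun h2 => ?_)
      exact zero_ne_one ((add_zero 0).symm.trans ((congrArg₂ (· + ·) h1 h2).symm.trans h))
    · exact Or.inl ((isUnit_germ_ofField_iff (U := V) hV (s := fun y => s' ⟨y.1, hVU y.2⟩)).mpr h1)
  exists_isAffineOpen x := ⟨⊤, trivial, isAffineOpen_ofField⟩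

variable {k} {X : Superscheme.{u}}

/-- The morphism `Spec k → X` with image `x` given by a local homomorphism from the stalk at `x`
to `k`. -/
noncomputable def fromField (x : X.carrier) (φ : X.presheaf.stalk x →+* k)
    (hφ : ∀ a, φ a ≠ 0 ↔ IsUnit a) :
    ofField k ⟶ X where
  base := TopCat.ofHom (ContinuousMap.const PUnit.{u + 1} x)
  c :=
    { app := fun (U : (Opens X.carrier)ᵒᵖ) => RingCat.ofHom
        { toFun := fun s y => φ (X.presheaf.germ U.unop x y.2 s)
          map_one' := by funext y; simp
          map_zero' := by funext y; simp
          map_add' := fun _ _ => by funext y; simp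
          map_mul' := fun _ _ => by funext y; simp }
      naturality := fun (U V : (Opens X.carrier)ᵒᵖ) i => by
        ext s
        funext y
        exact congrArg φ (X.presheaf.germ_res_apply i.unop x y.2 s) }
  map_mem U p s hs hp := by
    obtain rfl : p = 1 := (SuperRing.zero_or_one p).resolve_left hp
    funext y
    exact not_not.mp fun h => not_isUnit_germ_odd (X := X) (x := x) y.2 hs ((hφ _).mp h)
  isLocalHom y := isLocalHom_stalkMap_of _ y fun U hU s h =>
    (hφ _).mp ((isUnit_germ_ofField_iff hU).mp h)

/-- The value in `k` of a section of `𝒪_X` at a `k`-point of `X`. -/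
def value (q : ofField k ⟶ X) {U : Opens X.carrier} (h : q.base PUnit.unit ∈ U) :
    X.presheaf.obj (op U) →+* k :=
  (Pi.evalRingHom (fun _ : (Opens.map q.base).obj U => k) ⟨PUnit.unit, h⟩).comp
    (q.c.app (op U)).hom

lemma value_ne_zero_iff (q : ofField k ⟶ X) {U : Opens X.carrier} (h : q.base PUnit.unit ∈ U)
    (s : X.presheaf.obj (op U)) :
    value q h s ≠ 0 ↔ IsUnit (X.presheaf.germ U (q.base PUnit.unit) h s) := by
  exact (isUnit_germ_ofField_iff (U := (Opens.map q.base).obj U) h).symm.trans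
    (isUnit_germ_app_iff q PUnit.unit h s)

lemma value_map (q : ofField k ⟶ X) {U V : Opens X.carrier} (i : V ⟶ U)
    (h : q.base PUnit.unit ∈ V) (s : X.presheaf.obj (op U)) :
    value q h (X.presheaf.map i.op s) = value q (i.le h) s := by
  exact congrFun (app_map q i s) _

lemma hom_ext_of_value {q r : ofField k ⟶ X} (hb : q.base PUnit.unit = r.base PUnit.unit)
    (h : ∀ (U : Opens X.carrier) (hq : q.base PUnit.unit ∈ U) (hr : r.base PUnit.unit ∈ U)
      (s : X.presheaf.obj (op U)), value q hq s = value r hr s) : q = r := by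
  refine hom_ext_of_sections (by ext y; exact hb) fun U s i => ?_
  funext y
  exact h U y.2 (i.le y.2) s

/-- Two `k`-points of `X` in an affine open are equal if all functions on it take the same values
at them. -/
lemma hom_ext_of_isAffineOpen {q r : ofField k ⟶ X} {U : Opens X.carrier} (hU : X.IsAffineOpen U)
    (hq : q.base PUnit.unit ∈ U) (hr : r.base PUnit.unit ∈ U)
    (h : ∀ s : X.presheaf.obj (op U), value q hq s = value r hr s) : q = r := by
  obtain ⟨e, he⟩ := hU.exists_homeomorph
  have hb : q.base PUnit.unit = r.base PUnit.unit := by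
    have : e ⟨_, hq⟩ = e ⟨_, hr⟩ := PrimeSpectrum.ext <| Ideal.ext fun s => by
      rw [he, he, ← value_ne_zero_iff, ← value_ne_zero_iff, h]
    exact congrArg Subtype.val (e.injective this)
  refine hom_ext_of_value hb fun V hqV hrV s => ?_
  -- A basic open `D(f)` of `U` around the point on which `s` is defined.
  have hopen : IsOpen (e '' {y | y.1 ∈ V}) :=
    e.isOpenMap _ (V.isOpen.preimage continuous_subtype_val)
  obtain ⟨_, ⟨f, rfl⟩, hf1, hf2⟩ :=
    PrimeSpectrum.isTopologicalBasis_basic_opens.exists_subset_of_mem_open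
      (Set.mem_image_of_mem e (show (⟨_, hq⟩ : U) ∈ {y : U | y.1 ∈ V} from hqV)) hopen
  have hf : ∀ y : U, e y ∈ PrimeSpectrum.basicOpen f ↔
      IsUnit (X.presheaf.germ U y.1 y.2 f.1) := fun y => by
    rw [PrimeSpectrum.mem_basicOpen, he, not_not]
  let D : Opens X.carrier := ⟨Subtype.val '' {y : U | e y ∈ PrimeSpectrum.basicOpen f},
    U.isOpen.isOpenMap_subtype_val _
      ((PrimeSpectrum.basicOpen f).isOpen.preimage e.continuous)⟩
  have hD : IsBasicOpen f.1 D := fun y =>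
    ⟨fun ⟨z, hz, hzy⟩ => hzy ▸ ⟨z.2, (hf z).mp hz⟩,
      fun ⟨hy, hu⟩ => ⟨⟨y, hy⟩, (hf ⟨y, hy⟩).mpr hu, rfl⟩⟩
  have hDV : D ≤ V := by
    rintro _ ⟨z, hz, rfl⟩
    obtain ⟨w, hw, hwz⟩ := hf2 hz
    rw [← e.injective hwz]
    exact hw
  have hDU : D ≤ U := by
    rintro _ ⟨z, -, rfl⟩
    exact z.2
  have hqD : q.base PUnit.unit ∈ D := ⟨⟨_, hq⟩, hf1, rfl⟩
  have hrD : r.base PUnit.unit ∈ D := hb ▸ hqD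
  obtain ⟨n, a, ha⟩ := (hU.isLocalization f.1 f.2 D (homOfLE hDU) hD).2.1
    (X.presheaf.map (homOfLE hDV).op s)
  have e1 := congrArg (value q hqD) ha
  have e2 := congrArg (value r hrD) ha
  simp only [map_mul, map_pow, value_map] at e1 e2
  have hne : value q hq f.1 ≠ 0 :=
    (value_ne_zero_iff _ _ _).mpr ((hf ⟨_, hq⟩).mp hf1)
  rw [← h, ← h, ← e1] at e2
  exact mul_left_cancel₀ (pow_ne_zero n hne) e2.symm

end Superscheme

/-! ### The diagonal -/

namespace Superscheme

variable {X S P : Superscheme.{u}}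

lemma base_eq_of_comp_eq_id {d : X ⟶ P} {p : P ⟶ X} (e : d ≫ p = 𝟙 X) (x : X.carrier) :
    p.base (d.base x) = x :=
  congrArg (fun g : X ⟶ X => g.base x) e

lemma isEmbedding_base_of_comp_eq_id {d : X ⟶ P} {p : P ⟶ X} (e : d ≫ p = 𝟙 X) :
    Topology.IsEmbedding d.base :=
  Topology.IsEmbedding.of_leftInverse (f := p.base) (g := d.base) (base_eq_of_comp_eq_id e)
    p.base.hom.continuous d.base.hom.continuous

variable {f : X ⟶ S} {p₁ p₂ : P ⟶ X}

/-- The points of `X ×_S X` on the diagonal are those at which the two projections have the same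
value in the residue field. Over an affine open `U` of `X` this says that the functions
`p₁^* s - p₂^* s`, for `s ∈ 𝒪_X(U)`, are nowhere invertible, which is a closed condition. -/
lemma isLocallyClosed_range_diagonal (hP : IsPullback p₁ p₂ f f) :
    IsLocallyClosed (Set.range (hP.lift (𝟙 X) (𝟙 X) rfl).base) := by
  have e₁ := hP.lift_fst (𝟙 X) (𝟙 X) rfl
  have e₂ := hP.lift_snd (𝟙 X) (𝟙 X) rfl
  generalize hd : hP.lift (𝟙 X) (𝟙 X) rfl = d at *
  refine ((isLocallyClosed_tfae _).out 0 3).mpr ?_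
  rintro _ ⟨x, rfl⟩
  obtain ⟨U, hxU, hU⟩ := X.exists_isAffineOpen x
  let W₁ : Opens P.carrier := (Opens.map p₁.base).obj U
  let W₂ : Opens P.carrier := (Opens.map p₂.base).obj U
  refine ⟨(W₁ ⊓ W₂ : Opens P.carrier), ⟨?_, ?_⟩, (W₁ ⊓ W₂).isOpen, ?_⟩
  · change p₁.base (d.base x) ∈ U
    rwa [base_eq_of_comp_eq_id e₁]
  · change p₂.base (d.base x) ∈ U
    rwa [base_eq_of_comp_eq_id e₂]
  rintro w ⟨hwW, hw⟩
  have hw₁ : w ∈ W₁ := hwW.1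
  have hw₂ : w ∈ W₂ := hwW.2
  obtain ⟨k, _, φ, hφ⟩ := P.exists_residueField w
  let j : ofField k ⟶ P := fromField w φ hφ
  have hj : j ≫ p₁ = j ≫ p₂ := by
    refine hom_ext_of_isAffineOpen hU hw₁ hw₂ fun s => ?_
    change φ (P.presheaf.germ W₁ w hw₁ (p₁.c.app (op U) s)) =
      φ (P.presheaf.germ W₂ w hw₂ (p₂.c.app (op U) s))
    by_contra hne
    let i₁ : W₁ ⊓ W₂ ⟶ W₁ := homOfLE inf_le_left
    let i₂ : W₁ ⊓ W₂ ⟶ W₂ := homOfLE inf_le_right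
    let t := P.presheaf.map i₁.op (p₁.c.app (op U) s) - P.presheaf.map i₂.op (p₂.c.app (op U) s)
    have ht : ∀ (y : P.carrier) (hy : y ∈ W₁ ⊓ W₂), P.presheaf.germ (W₁ ⊓ W₂) y hy t =
        P.presheaf.germ W₁ y hy.1 (p₁.c.app (op U) s) -
          P.presheaf.germ W₂ y hy.2 (p₂.c.app (op U) s) := fun y hy => by
      rw [map_sub, P.presheaf.germ_res_apply, P.presheaf.germ_res_apply]
    have htw : IsUnit (P.presheaf.germ (W₁ ⊓ W₂) w hwW t) := by
      rw [← hφ, ht, map_sub]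
      exact sub_ne_zero.mpr hne
    -- If `t` is invertible at `w`, it is so at some point of the diagonal, along which `t` is zero.
    obtain ⟨V, i, hwV, hV⟩ := P.exists_isUnit_of_germ _ t htw
    obtain ⟨_, hyV, y, rfl⟩ := mem_closure_iff.mp hw V V.isOpen hwV
    have h1 := (hV.map (P.presheaf.germ V _ hyV).hom).map (d.toHom.stalkMap y).hom
    erw [P.presheaf.germ_res_apply, ht, map_sub] at h1
    have hyU : y ∈ U := by
      have : p₁.base (d.base y) ∈ U := (i.le hyV).1
      rwa [base_eq_of_comp_eq_id e₁] at this
    rw [stalkMap_germ_comp e₁ y (i.le hyV).1 hyU, stalkMap_germ_comp e₂ y (i.le hyV).2 hyU,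
      sub_self] at h1
    have := X.isLocalRing_stalk y
    exact not_isUnit_zero h1
  have hjd : j = (j ≫ p₁) ≫ d := by
    refine hP.hom_ext ?_ ?_
    · rw [Category.assoc, e₁, Category.comp_id]
    · rw [Category.assoc, e₂, Category.comp_id, hj]
  exact ⟨p₁.base w, congrArg (fun g : ofField k ⟶ P => g.base PUnit.unit) hjd.symm⟩

end Superscheme

/-! ### The homological vector field -/

namespace OddLineAction

open Superscheme SuperRing GradedRing

variable {X S P : Superscheme.{u}} {f : X ⟶ S} (σ : OddLineAction f)

/-- The homomorphism `s ↦ σ^*(s) = s + ε v(s)`. -/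
def coaction (U : Opens X.carrier) : X.presheaf.obj (op U) →+* OddExt (X.parity U) :=
  (X.toSuperRingedSpace.oddLineMap (homOfLE (σ.le_preimage U))).comp (σ.act.c.app (op U)).hom

variable {U V : Opens X.carrier}

lemma coaction_re (s : X.presheaf.obj (op U)) : (σ.coaction U s).re = s :=
  (map_app_congr σ.zero_act s (homOfLE (σ.le_preimage U)) (𝟙 U)).trans (X.map_self _ _)

lemma coaction_eps (s : X.presheaf.obj (op U)) : (σ.coaction U s).eps = σ.vectorField s := rfl

lemma coaction_eq (s : X.presheaf.obj (op U)) : σ.coaction U s = ⟨s, σ.vectorField s⟩ :=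
  OddExt.ext (σ.coaction_re s) rfl

lemma vectorField_one : σ.vectorField (1 : X.presheaf.obj (op U)) = 0 := by
  rw [← coaction_eps, map_one, OddExt.eps_one]

lemma vectorField_add (s t : X.presheaf.obj (op U)) :
    σ.vectorField (s + t) = σ.vectorField s + σ.vectorField t := by
  simp only [← coaction_eps, map_add, OddExt.eps_add]

lemma vectorField_mul (s t : X.presheaf.obj (op U)) :
    σ.vectorField (s * t) =
      σ.vectorField s * t + parityInvol (X.parity U) s * σ.vectorField t := by
  simp only [← coaction_eps, map_mul, OddExt.eps_mul, coaction_re]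

lemma vectorField_mem {p : ZMod 2} {s : X.presheaf.obj (op U)} (hs : s ∈ X.parity U p) :
    σ.vectorField s ∈ X.parity U (p + 1) :=
  X.map_mem _ _ _ (σ.act.map_mem U p s hs).2

lemma vectorField_mem_even {s : X.presheaf.obj (op U)} (hs : s ∈ X.parity U 1) :
    σ.vectorField s ∈ X.parity U 0 :=
  σ.vectorField_mem hs

lemma vectorField_mem_odd {s : X.presheaf.obj (op U)} (hs : s ∈ X.parity U 0) :
    σ.vectorField s ∈ X.parity U 1 :=
  σ.vectorField_mem hs

/-- As `v` is odd, a solution of `v(t) = 1` may be replaced by its odd part. -/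
lemma vectorField_proj_one {t : X.presheaf.obj (op U)} (h : σ.vectorField t = 1) :
    σ.vectorField (proj (X.parity U) 1 t) = 1 := by
  have h0 := congrArg (proj (X.parity U) 0) h
  rw [← proj_zero_add_proj_one (X.parity U) t, vectorField_add, map_add,
    proj_ne _ (σ.vectorField_mem_odd (proj_mem _ _ _)) (show (1 : ZMod 2) ≠ 0 by decide),
    proj_same _ (σ.vectorField_mem_even (proj_mem _ _ _)),
    proj_same _ SetLike.GradedOne.one_mem, zero_add] at h0
  exact h0

lemma vectorField_map (i : V ⟶ U) (s : X.presheaf.obj (op U)) :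
    σ.vectorField (X.presheaf.map i.op s) = X.presheaf.map i.op (σ.vectorField s) := by
  unfold vectorField
  have e := congrArg OddExt.eps (app_map σ.act i s)
  refine (congrArg (X.presheaf.map (homOfLE (σ.le_preimage V)).op) e).trans ?_
  exact (SuperRingedSpace.map_map _ _ (i ≫ homOfLE (σ.le_preimage U)) _).trans
    (SuperRingedSpace.map_map _ _ _ _).symm

/-- `v² = 0`: compare the coefficients of `ε₁ε₂` on both sides of `(g + h) x = g (h x)`. -/
lemma vectorField_vectorField (s : X.presheaf.obj (op U)) :
    σ.vectorField (σ.vectorField s) = 0 := by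
  have hU : U ≤ (Opens.map σ.act.base).obj ((Opens.map σ.act.base).obj U) :=
    (σ.le_preimage U).trans (σ.le_preimage _)
  have e := congrArg (fun z => OddExt.eps (OddExt.eps z)) (map_app_congr σ.add_act s
    (V := U) (homOfLE (σ.le_preimage U)) (homOfLE hU))
  have e' : 0 = X.presheaf.map (homOfLE hU).op (OddExt.eps (σ.act.c.app _
      (OddExt.eps (σ.act.c.app (op U) s)))) :=
    (map_zero (X.presheaf.map (homOfLE (σ.le_preimage U)).op).hom).symm.trans e
  refine (σ.vectorField_map (homOfLE (σ.le_preimage U))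
    (OddExt.eps (σ.act.c.app (op U) s))).trans (Eq.trans ?_ e'.symm)
  exact SuperRingedSpace.map_map _ _ _ _

/-- On even functions `v` takes odd, hence nilpotent, values. -/
lemma not_isUnit_germ_vectorField {x : X.carrier}
    (h : ∀ (U : Opens X.carrier) (hx : x ∈ U), ∀ θ ∈ X.parity U 1,
      ¬ IsUnit (X.presheaf.germ U x hx (σ.vectorField θ)))
    (hx : x ∈ U) (s : X.presheaf.obj (op U)) :
    ¬ IsUnit (X.presheaf.germ U x hx (σ.vectorField s)) := by
  have := X.isLocalRing_stalk x
  rw [← proj_zero_add_proj_one (X.parity U) s, vectorField_add, map_add]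
  exact fun hu => (IsLocalRing.isUnit_or_isUnit_of_isUnit_add hu).elim
    (not_isUnit_germ_odd hx (σ.vectorField_mem_odd (proj_mem _ _ _))) (h U hx _ (proj_mem _ _ _))

/-! ### The conditions on functions -/

lemma LocallySumEqOne.locallyExistsIsUnit (h : σ.LocallySumEqOne) : σ.LocallyExistsIsUnit := by
  intro x
  obtain ⟨U, hx, n, p, a, b, hab, hsum⟩ := h x
  have := X.isLocalRing_stalk x
  have h1 : IsUnit (∑ i, X.presheaf.germ U x hx (a i * σ.vectorField (b i))) := by
    rw [← map_sum, hsum, map_one]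
    exact isUnit_one
  obtain ⟨i, -, hi⟩ := IsLocalRing.exists_of_isUnit_sum h1
  rw [map_mul] at hi
  obtain ⟨ha, hb⟩ := hab i
  obtain hp | hp := zero_or_one (p i)
  · obtain ⟨V, j, hV, hu⟩ := X.exists_isUnit_of_germ hx _ (IsLocalRing.isUnit_of_isUnit_mul_left hi)
    refine ⟨V, hV, X.presheaf.map j.op (b i), X.map_mem j _ _ (by simpa [hp] using hb), ?_⟩
    rwa [vectorField_map]
  · exact absurd (IsLocalRing.isUnit_of_isUnit_mul_right hi) (not_isUnit_germ_odd hx (hp ▸ ha))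

lemma LocallyExistsIsUnit.locallyExistsEqOne (h : σ.LocallyExistsIsUnit) :
    σ.LocallyExistsEqOne := by
  intro x
  obtain ⟨U, hx, θ, hθ, w, hw⟩ := h x
  -- The inverse `w⁻¹` of `v(θ)` is killed by `v`: apply `v` to `v(θ) w⁻¹ = 1`. Hence
  -- `v(θ w⁻¹) = 1`, and so has the odd part of `θ w⁻¹`.
  have hv : σ.vectorField (↑w⁻¹ : X.presheaf.obj (op U)) = 0 := by
    have h1 := σ.vectorField_mul (w : X.presheaf.obj (op U)) ↑w⁻¹
    rw [Units.mul_inv, vectorField_one, hw, vectorField_vectorField, zero_mul, zero_add,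
      parityInvol_even _ (σ.vectorField_mem_even hθ), ← hw] at h1
    rw [← w.inv_mul_cancel_left (σ.vectorField ↑w⁻¹), ← h1, mul_zero]
  have h2 : σ.vectorField (θ * (↑w⁻¹ : X.presheaf.obj (op U))) = 1 := by
    rw [vectorField_mul, hv, mul_zero, add_zero, ← hw, Units.mul_inv]
  refine ⟨U, hx, proj (X.parity U) 1 (θ * (↑w⁻¹ : X.presheaf.obj (op U))), proj_mem _ _ _, ?_⟩
  exact σ.vectorField_proj_one h2

lemma LocallyExistsEqOne.locallySumEqOne (h : σ.LocallyExistsEqOne) : σ.LocallySumEqOne := by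
  intro x
  obtain ⟨U, hx, θ, hθ, h1⟩ := h x
  refine ⟨U, hx, 1, fun _ => 0, fun _ => 1, fun _ => θ,
    fun _ => ⟨SetLike.GradedOne.one_mem, hθ⟩, ?_⟩
  rw [Fin.sum_univ_one, one_mul, h1]

/-- If `v(θ) = 1`, then multiplication by `θ` is a homotopy contracting the complex `(𝒪_X, v)`. -/
lemma LocallyExistsEqOne.kerEqImage (h : σ.LocallyExistsEqOne) : σ.KerEqImage := by
  intro U s
  constructor
  · intro hs x hx
    obtain ⟨V, hV, θ, hθ, h1⟩ := h x
    let i : V ⊓ U ⟶ V := homOfLE inf_le_left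
    let j : V ⊓ U ⟶ U := homOfLE inf_le_right
    refine ⟨V ⊓ U, j, ⟨hV, hx⟩, X.presheaf.map i.op θ * X.presheaf.map j.op s, ?_⟩
    rw [vectorField_mul, vectorField_map, vectorField_map, h1, hs, map_one, map_zero, mul_zero,
      one_mul, add_zero]
  · intro hs
    refine X.section_ext fun x hx => ?_
    obtain ⟨V, i, hV, t, ht⟩ := hs x hx
    refine ⟨V, i, hV, ?_⟩
    rw [← vectorField_map, ← ht, vectorField_vectorField, map_zero]

lemma KerEqImage.locallyExistsEqOne (h : σ.KerEqImage) : σ.LocallyExistsEqOne := by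
  intro x
  obtain ⟨V, i, hV, t, ht⟩ := (h ⊤ 1).mp σ.vectorField_one x trivial
  rw [map_one] at ht
  exact ⟨V, hV, _, proj_mem _ _ _, σ.vectorField_proj_one ht⟩

/-! ### The shear morphism -/

variable {p₁ p₂ : P ⟶ X} (hP : IsPullback p₁ p₂ f f)

lemma oddLineZero_shear : X.oddLineZero ≫ σ.shear hP = hP.lift (𝟙 X) (𝟙 X) rfl := by
  refine hP.hom_ext ?_ ?_
  · rw [Category.assoc, shear, hP.lift_fst, hP.lift_fst, σ.zero_act]
  · rw [Category.assoc, shear, hP.lift_snd, hP.lift_snd]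
    rfl

/-- The zero section is the identity on points, so the shear morphism and the diagonal agree on
points. -/
lemma shear_base_eq : ⇑(σ.shear hP).base = ⇑(hP.lift (𝟙 X) (𝟙 X) rfl).base := by
  rw [← σ.oddLineZero_shear hP]
  rfl

/-- If `v(θ) = 1`, then `ε = p₁^* θ - p₂^* θ` on `𝔸^{0|1} × X`, so `ε` and with it all of
`𝒪_X[ε]` is in the image of the shear morphism. -/
lemma LocallyExistsEqOne.shear_stalkMap_surjective (h : σ.LocallyExistsEqOne)
    (x : X.oddLine.carrier) :
    Function.Surjective ((σ.shear hP).toHom.stalkMap x).hom := by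
  intro z
  obtain ⟨V, hV, θ₀, hθ₀, h₀⟩ := h x
  obtain ⟨U, hUV, hU, a, b, rfl⟩ := exists_germ_oddLine_eq z hV
  let θ := X.presheaf.map (homOfLE hUV).op θ₀
  have h1 : σ.coaction U θ = ⟨θ, 1⟩ := by rw [coaction_eq, vectorField_map, h₀, map_one]
  have e₁ : σ.shear hP ≫ p₁ = σ.act := hP.lift_fst _ _ _
  have e₂ : σ.shear hP ≫ p₂ = X.oddLineProj := hP.lift_snd _ _ _
  have hx₁ : p₁.base ((σ.shear hP).base x) = x :=
    (congrArg (fun g : X.oddLine ⟶ X => g.base x) e₁).trans (σ.base_apply x)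
  have hx₂ : p₂.base ((σ.shear hP).base x) = x :=
    congrArg (fun g : X.oddLine ⟶ X => g.base x) e₂
  have g₂ : ∀ s : X.presheaf.obj (op U), ∃ t, ((σ.shear hP).toHom.stalkMap x).hom t =
      X.oddLine.presheaf.germ U x hU (⟨s, 0⟩ : OddExt (X.parity U)) := fun s =>
    ⟨_, stalkMap_germ_comp e₂ x (hx₂.symm ▸ hU) hU s⟩
  have g₁ : ∃ t, ((σ.shear hP).toHom.stalkMap x).hom t =
      X.oddLine.presheaf.germ U x hU (⟨θ, 1⟩ : OddExt (X.parity U)) := by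
    have hU' : σ.act.base x ∈ U := σ.le_preimage U hU
    refine ⟨_, (stalkMap_germ_comp e₁ x (hx₁.symm ▸ hU) hU' θ).trans ?_⟩
    rw [← h1]
    exact (X.oddLine.presheaf.germ_res_apply (homOfLE (σ.le_preimage U)) x hU _).symm
  obtain ⟨ta, hta⟩ := g₂ a
  obtain ⟨tb, htb⟩ := g₂ b
  obtain ⟨t1, ht1⟩ := g₁
  obtain ⟨t2, ht2⟩ := g₂ θ
  refine ⟨ta + (t1 - t2) * tb, ?_⟩
  let A : OddExt (X.parity U) := (⟨a, 0⟩ : OddExt (X.parity U)) +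
    ((⟨θ, 1⟩ : OddExt (X.parity U)) - ⟨θ, 0⟩) * ⟨b, 0⟩
  have hA : A = ⟨a, b⟩ := by
    ext <;> simp [A, sub_eq_add_neg]
  rw [map_add, map_mul, map_sub, hta, htb, ht1, ht2, ← hA]
  erw [← map_sub, ← map_mul, ← map_add]
  rfl

/-- If all functions `v(s)` vanish at `x`, then the two compositions of the shear morphism over
`Spec κ(x)[ε]` with the projections agree, so that it maps to the diagonal without involving `ε`.
Hence `ε` is not in the image of the stalk of `X ×_S X`. -/
lemma locallyExistsIsUnit_of_shear_stalkMap_surjective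
    (h : ∀ x, Function.Surjective ((σ.shear hP).toHom.stalkMap x).hom) :
    σ.LocallyExistsIsUnit := by
  intro x
  by_contra hne
  have hv := fun U hx => σ.not_isUnit_germ_vectorField (x := x) (U := U) (fun U hx θ hθ hu => by
    obtain ⟨V, i, hV, hu⟩ := X.exists_isUnit_of_germ hx _ hu
    exact hne ⟨V, hV, _, X.map_mem i _ _ hθ, by rwa [vectorField_map]⟩) hx
  obtain ⟨k, _, φ, hφ⟩ := X.exists_residueField x
  let q : ofField k ⟶ X := fromField x φ hφ
  have hq : Superscheme.oddLineMap q ≫ σ.act = (ofField k).oddLineProj ≫ q := by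
    refine hom_ext_of_sections (by ext y; exact σ.base_apply x) fun U s i => ?_
    refine OddExt.ext (funext fun y => ?_) (funext fun y => ?_)
    · have hx : x ∈ U := i.le y.2
      refine congrArg φ ?_
      refine (X.presheaf.germ_res_apply (homOfLE (σ.le_preimage U)) x hx _).symm.trans ?_
      exact congrArg (X.presheaf.germ U x hx) (σ.coaction_re s)
    · have hx : x ∈ U := i.le y.2
      have h0 : φ (X.presheaf.germ U x hx (σ.vectorField s)) = 0 :=
        not_not.mp fun h0 => hv U hx s ((hφ _).mp h0)
      refine Eq.trans (congrArg φ ?_) h0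
      exact (X.presheaf.germ_res_apply (homOfLE (σ.le_preimage U)) x hx _).symm
  have hqs : Superscheme.oddLineMap q ≫ σ.shear hP =
      (ofField k).oddLineProj ≫ q ≫ hP.lift (𝟙 X) (𝟙 X) rfl := by
    refine hP.hom_ext ?_ ?_
    · simp only [Category.assoc, shear, hP.lift_fst, Category.comp_id]
      exact hq
    · simp only [Category.assoc, shear, hP.lift_snd, Category.comp_id]
      exact hom_ext_of_sections rfl fun U s i => OddExt.ext rfl (map_zero (q.c.app (op U)).hom)
  obtain ⟨t₀, ht₀⟩ := h x (X.oddLine.presheaf.germ ⊤ x trivial (⟨0, 1⟩ : OddExt (X.parity ⊤)))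
  obtain ⟨W, hW, t, rfl⟩ := P.presheaf.exists_germ_eq t₀
  replace ht₀ := (stalkMap_germ (σ.shear hP) x hW t).symm.trans ht₀
  let W' : Opens X.carrier := (Opens.map (σ.shear hP).base).obj W
  let e : OddExt (X.parity W') := (σ.shear hP).c.app (op W) t
  obtain ⟨V, hxV, i, j, hV⟩ := X.oddLine.presheaf.germ_eq x _ _ _ _ ht₀
  have he : X.presheaf.germ W' x hW e.eps = 1 := by
    have h1 : X.presheaf.map i.op e.eps = 1 :=
      (congrArg OddExt.eps hV).trans (map_one (X.presheaf.map j.op).hom)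
    exact (X.presheaf.germ_res_apply i x hxV _).symm.trans
      ((congrArg (X.presheaf.germ V x hxV) h1).trans (map_one (X.presheaf.germ V x hxV).hom))
  let Q : Opens PUnit.{u + 1} := ⊤
  have hc := map_app_congr hqs t (V := Q) (homOfLE fun y _ => hW)
    (homOfLE fun y _ => show (hP.lift (𝟙 X) (𝟙 X) rfl).base x ∈ W from
      congrFun (σ.shear_base_eq hP) x ▸ hW)
  have h2 : φ (X.presheaf.germ W' x hW e.eps) = 0 :=
    congrFun (congrArg OddExt.eps hc) ⟨PUnit.unit, trivial⟩
  rw [he, map_one] at h2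
  exact one_ne_zero h2

lemma shear_stalkMap_surjective_iff :
    (∀ x, Function.Surjective ((σ.shear hP).toHom.stalkMap x).hom) ↔ σ.LocallySumEqOne :=
  ⟨fun h => ((σ.locallyExistsIsUnit_of_shear_stalkMap_surjective hP h).locallyExistsEqOne σ
    |>.locallySumEqOne σ),
  fun h => ((h.locallyExistsIsUnit σ).locallyExistsEqOne σ).shear_stalkMap_surjective σ hP⟩

end OddLineAction

theorem mainTheorem11 {X S : Superscheme.{u}} (f : X ⟶ S) (σ : OddLineAction f) :
    List.TFAE [σ.LocallySumEqOne, σ.LocallyExistsIsUnit, σ.LocallyExistsEqOne, σ.KerEqImage] ∧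
    ∀ {P : Superscheme.{u}} {p₁ p₂ : P ⟶ X} (hP : IsPullback p₁ p₂ f f),
      (Superscheme.IsSeparated hP → (σ.IsFree hP ↔ σ.LocallySumEqOne)) ∧
      (Superscheme.IsLocallyClosedEmbedding (σ.shear hP) ↔ σ.LocallySumEqOne) := by
  constructor
  · tfae_have 1 → 2 := fun h => h.locallyExistsIsUnit σ
    tfae_have 2 → 3 := fun h => h.locallyExistsEqOne σ
    tfae_have 3 → 1 := fun h => h.locallySumEqOne σ
    tfae_have 3 → 4 := fun h => h.kerEqImage σ
    tfae_have 4 → 3 := fun h => h.locallyExistsEqOne σ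
    tfae_finish
  · intro P p₁ p₂ hP
    rw [← σ.shear_stalkMap_surjective_iff hP]
    refine ⟨fun hX => ⟨fun h => h.stalkMap_surjective, fun h => ⟨?_, h⟩⟩,
      fun h => h.stalkMap_surjective, fun h => ⟨?_, ?_, h⟩⟩
    · exact (σ.shear_base_eq hP).symm ▸ hX.base
    · exact (σ.shear_base_eq hP).symm ▸
        Superscheme.isEmbedding_base_of_comp_eq_id (hP.lift_fst (𝟙 X) (𝟙 X) rfl)
    · exact (σ.shear_base_eq hP).symm ▸ Superscheme.isLocallyClosed_range_diagonal hP
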